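/- **Notation.** Elements of $\mathbb R^3$ are column vectors, elements of $(\mathbb R^3)^*$ row vectors, and $\mathbf v\times\mathbf w:=\mathrm{vol}(\mathbf v,\mathbf w,\cdot)\in(\mathbb R^3)^*$. Let $\mathbb{RP}^2=\mathbb P(\mathbb R^3)$, $\mathbb{RP}^{2*}=\mathbb P((\mathbb R^3)^*)$, with projections $\pi,\bar\pi$ from $\mathbb R^3\setminus 0$, $(\mathbb R^3)^*\setminus 0$. Let $Q^5=\{(\mathbf q,\mathbf p)\in\mathbb R^3\times(\mathbb R^3)^*: \mathbf p\mathbf q=1\}$ and let $\mathcal D=\ker(d\mathbf p-\mathbf q\times d\mathbf q)\subset TQ^5$ be the Cartan–Engel distribution; its integral curves are the curves in $Q^5$ with $\mathbf p'=\mathbf q\times\mathbf q'$. A *projective contact element* is a triple $(q,p,\psi)$, where $q\in\mathbb{RP}^2$ and $p\in\mathbb{RP}^{2*}$ are non-incident and $\psi:T_q\mathbb{RP}^2\to T_p\mathbb{RP}^{2*}$ is a linear isomorphism whose projectivization sends each line $\ell$ through $q$ to the point $\ell\cap p$. (Here $\mathbb P(T_q\mathbb{RP}^2)$ is the pencil of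 lines through $q$, and $\mathbb P(T_p\mathbb{RP}^{2*})$ is the set of points of the line $p$.) The space of projective contact elements is $\mathcal{PC}$. **Parallel lines.** Let $c(t)$ be a locally convex curve (regular, without inflection points) in a projective plane, and let $\mathcal C_t$ be its osculating conic at $c(t)$, i.e. the unique conic tangent to the curve to order $4$ at $c(t)$. A *development* of $c$ is a curve $x(t)\in\mathcal C_t$ that is tangent at $x(t)$ to the line through $x(t)$ and $c(t)$; where $x(t)=c(t)$ the condition is $x'(t)=0$, by which the line field on the bundle of osculating conics extends smoothly. A family of lines $\ell(t)$ through $c(t)$, i.e. a section of the projectivized tangent bundle along $c$, is *parallel* if there is a development $x(t)$ such that $\ell(t)$ joins $c(t)$ and $x(t)$ when $x(t)\ne c(t)$, and is the tangent line of $c$ when $x(t)=c(t)$. A curve $(q(t),p(t),\psi(t))$ in $\mathcal{PC}$ satisfies the *no-slip condition* if $\psi(t)q'(t)=p'(t)$ for all $t$, and the *no-twist condition* if for every parallel section $u(t)$ of $\mathbb P(T\mathbb{RP}^2)$ along $q(t)$, $\psi(t)u(t)$ is a parallel section of $\mathbb P(T\mathbb{RP}^{2*})$ along $p(t)$. **Proposition.**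 There is a bijection $\Phi:Q^5\to\mathcal{PC}$, $(\mathbf q,\mathbf p)\mapsto([\mathbf q],[\mathbf p],\psi)$, where $\psi(d\pi_{\mathbf q}(\mathbf v))=d\bar\pi_{\mathbf p}(\mathbf q\times\mathbf v)$ for all $\mathbf v\in\mathbb R^3$; a parametrized curve $\Gamma$ in $Q^5$, defined on an open interval, is smooth if and only if $\Phi\circ\Gamma$ is smooth. If $\Gamma(t)=(\mathbf q(t),\mathbf p(t))$ is a smooth curve in $Q^5$, defined on an open interval, such that $q(t)=[\mathbf q(t)]$ is locally convex, then $\Gamma$ is an integral curve of $(Q^5,\mathcal D)$ if and only if $\Phi\circ\Gamma=(q(t),p(t),\psi(t))$ satisfies both the no-slip and the no-twist condition. -/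

import Mathlib

open Filter Topology Asymptotics
open scoped ContDiff LinearAlgebra.Projectivization Matrix

namespace ProjRolling

/-- The space `ℝ³` of column vectors.  Row vectors, i.e. elements of `(ℝ³)*`, are triples as well;
the row `p` is paired with the column `q` by `p ⬝ᵥ q`. -/
abbrev R3 : Type := Fin 3 → ℝ

/-! ### The quadric `Q⁵` and the Cartan-Engel distribution -/

/-- The affine quadric `Q⁵ = {(q, p) ∈ ℝ³ × (ℝ³)* | p q = 1}`. -/
def Q5 : Type := {x : R3 × R3 // x.2 ⬝ᵥ x.1 = 1}

/-- The vector component of a point of `Q⁵`. -/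
def Q5.vec (x : Q5) : R3 := x.1.1

/-- The covector component of a point of `Q⁵`. -/
def Q5.cov (x : Q5) : R3 := x.1.2

theorem Q5.vec_ne_zero (x : Q5) : x.vec ≠ 0 := by
  intro h
  have hx : x.cov ⬝ᵥ x.vec = 1 := x.2
  rw [h, dotProduct_zero] at hx
  exact zero_ne_one hx

theorem Q5.cov_ne_zero (x : Q5) : x.cov ≠ 0 := by
  intro h
  have hx : x.cov ⬝ᵥ x.vec = 1 := x.2
  rw [h, zero_dotProduct] at hx
  exact zero_ne_one hx

/-- The tangent space of `Q⁵` at `x`, as a subspace of `ℝ³ × (ℝ³)*`. -/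
def Q5.tangent (x : Q5) : Submodule ℝ (R3 × R3) where
  carrier := {w | w.2 ⬝ᵥ x.vec + x.cov ⬝ᵥ w.1 = 0}
  zero_mem' := by simp
  add_mem' := by
    intro a b ha hb
    simp only [Set.mem_ofPred_eq, Prod.fst_add, Prod.snd_add, add_dotProduct,
      dotProduct_add] at *
    linarith
  smul_mem' := by
    intro c a ha
    simp only [Set.mem_ofPred_eq, Prod.smul_fst, Prod.smul_snd, smul_dotProduct,
      dotProduct_smul, smul_eq_mul] at *
    rw [← mul_add, ha, mul_zero]

/-- The `(ℝ³)*`-valued one-form `ω = dp - q × dq` at `x`. -/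
noncomputable def oneForm (x : Q5) : R3 × R3 →ₗ[ℝ] R3 :=
  LinearMap.snd ℝ R3 R3 - (crossProduct x.vec).comp (LinearMap.fst ℝ R3 R3)

/-- The Cartan-Engel distribution `D = ker ω ⊂ TQ⁵`. -/
noncomputable def distribution (x : Q5) : Submodule ℝ (R3 × R3) :=
  x.tangent ⊓ LinearMap.ker (oneForm x)

/-- Smoothness on `I` of a parametrized curve in `Q⁵ ⊂ ℝ³ × (ℝ³)*`. -/
def Q5.SmoothCurveOn (Γ : ℝ → Q5) (I : Set ℝ) : Prop :=
  ∀ t ∈ I, ContDiffAt ℝ ∞ (fun s => (Γ s).1) t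

/-- `Γ` is an integral curve of `(Q⁵, D)` on `I`: its velocity is in `D` at each moment. -/
def IsIntegralCurve (Γ : ℝ → Q5) (I : Set ℝ) : Prop :=
  ∀ t ∈ I, ∃ w ∈ distribution (Γ t), HasDerivAt (fun s => (Γ s).1) w t

/-! ### Tangent vectors and curves in a projective plane

Everything here is stated for `ℙ(ℝ³)`, and is used both for `RP² = ℙ(ℝ³)` and, through the
coordinates of row vectors, for `RP²* = ℙ((ℝ³)*)`. -/

/-- The projective plane `ℙ(ℝ³)`, the space of one-dimensional subspaces of `ℝ³`. -/
abbrev Plane : Type := ℙ ℝ R3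

/-- The tangent space `T_q ℙ(ℝ³) = Hom(q, ℝ³ / q)` at the one-dimensional subspace `q`. -/
abbrev Tang (q : Plane) : Type := q.submodule →ₗ[ℝ] (R3 ⧸ q.submodule)

/-- `v = dπ_a(X)`, where `π : ℝ³ ∖ 0 → ℙ(ℝ³)` is the projection, `π(a) = q` and `X ∈ ℝ³`:
the tangent vector `dπ_a(X) ∈ Hom(q, ℝ³ / q)` sends `a` to the class of `X`. -/
def IsDPi {q : Plane} (a X : R3) (v : Tang q) : Prop :=
  a ≠ 0 ∧ ∃ h : a ∈ q.submodule, v ⟨a, h⟩ = Submodule.Quotient.mk X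

/-- The subspace of `ℝ³` spanned by `q` and the tangent vector `v` at `q`.  For `v ≠ 0` it is a
plane, and it represents the projective line through `q` that is tangent to `v`. -/
noncomputable def lineOf {q : Plane} (v : Tang q) : Submodule ℝ R3 :=
  (LinearMap.range v).comap q.submodule.mkQ

/-- `A` lifts the curve `c` to `ℝ³ ∖ 0` near `t`. -/
def IsLiftNear (c : ℝ → Plane) (A : ℝ → R3) (t : ℝ) : Prop :=
  ∀ᶠ s in 𝓝 t, A s ≠ 0 ∧ A s ∈ (c s).submodule

/-- `A` lifts the curve `c` to `ℝ³ ∖ 0` near `t` and is smooth at `t`. -/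
def IsSmoothLift (c : ℝ → Plane) (A : ℝ → R3) (t : ℝ) : Prop :=
  IsLiftNear c A t ∧ ContDiffAt ℝ ∞ A t

/-- Smoothness on `I` of a parametrized curve in the projective plane (`π` is a submersion). -/
def SmoothCurveOn (c : ℝ → Plane) (I : Set ℝ) : Prop :=
  ∀ t ∈ I, ∃ A, IsSmoothLift c A t

/-- `v = c'(t)`, that is, `v = dπ_{A(t)}(A'(t))` for a lift `A` of `c`. -/
def HasVelocityAt (c : ℝ → Plane) (t : ℝ) (v : Tang (c t)) : Prop :=
  ∃ (A : ℝ → R3) (A' : R3), IsLiftNear c A t ∧ HasDerivAt A A' t ∧ IsDPi (A t) A' v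

/-- `w` is a vector field along the curve `c` that is smooth at `t`. -/
def SmoothFieldAt (c : ℝ → Plane) (w : ∀ s, Tang (c s)) (t : ℝ) : Prop :=
  ∃ A X : ℝ → R3, IsSmoothLift c A t ∧ ContDiffAt ℝ ∞ X t ∧ ∀ᶠ s in 𝓝 t, IsDPi (A s) (X s) (w s)

/-- `c` is locally convex on `I`: it is regular (`c' ≠ 0`) and has no inflection points
(the normal acceleration `c''` mod `c'` does not vanish). -/
def LocallyConvexOn (c : ℝ → Plane) (I : Set ℝ) : Prop :=
  ∀ t ∈ I, ∃ A, IsSmoothLift c A t ∧ LinearIndependent ℝ ![A t, deriv A t, deriv (deriv A) t]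

/-! ### Osculating conics, developments, parallel lines -/

/-- The conic `{F = 0}` is tangent to `c` to order 4 at the parameter `t`. -/
def IsOsculatingConic (c : ℝ → Plane) (t : ℝ) (F : QuadraticForm ℝ R3) : Prop :=
  F ≠ 0 ∧ ∃ A, IsSmoothLift c A t ∧ (fun s => F (A s)) =O[𝓝 t] (fun s => (s - t) ^ 5)

/-- `x` is on the osculating conic of `c` at the parameter `t`. -/
def OnOsculatingConic (c : ℝ → Plane) (t : ℝ) (x : Plane) : Prop :=
  ∃ F, IsOsculatingConic c t F ∧ ∀ a ∈ x.submodule, F a = 0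

/-- `x` is a development of `c` on `I`: `x(t)` is on the osculating conic at `c(t)`, and `x` is
tangent at `x(t)` to the line through `x(t)` and `c(t)`.  The tangency says that `x'(t)` is in the
span of `x(t)` and `c(t)`.  At a moment with `x(t) = c(t)` this becomes `x'(t) = 0` (the development
has a cusp there), which is the smooth extension of the line field on the bundle of osculating
conics to the points `x = c(t)`. -/
def IsDevelopment (c x : ℝ → Plane) (I : Set ℝ) : Prop :=
  ∀ t ∈ I, OnOsculatingConic c t (x t) ∧
    ∃ v, HasVelocityAt x t v ∧ lineOf v ≤ (x t).submodule ⊔ (c t).submodule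

/-- Stereographic projection of the osculating conic at `c(t)` to the pencil of lines through
`c(t)`, which is `ℙ(T_{c(t)})`: a point `x ≠ c(t)` goes to the line joining `x` and `c(t)`, and
`c(t)` itself goes to the tangent line of `c`. -/
def IsStereographic (c : ℝ → Plane) (t : ℝ) (x : Plane) (u : ℙ ℝ (Tang (c t))) : Prop :=
  (x ≠ c t → lineOf u.rep = x.submodule ⊔ (c t).submodule) ∧
  (x = c t → ∃ v, HasVelocityAt c t v ∧ lineOf u.rep = lineOf v)

/-- The section `u` of `ℙ(T ℙ(ℝ³))` along `c` is parallel on `I`: it corresponds to a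
development of `c`. -/
def IsParallel (c : ℝ → Plane) (u : ∀ t, ℙ ℝ (Tang (c t))) (I : Set ℝ) : Prop :=
  ∃ x : ℝ → Plane, IsDevelopment c x I ∧ ∀ t ∈ I, IsStereographic c t (x t) (u t)

/-! ### Projective contact elements and projective rolling -/

/-- The annihilator of a subspace of `ℝ³` in `(ℝ³)*`, or of a subspace of `(ℝ³)*` in `ℝ³`. -/
def ann (W : Submodule ℝ R3) : Submodule ℝ R3 where
  carrier := {x | ∀ y ∈ W, y ⬝ᵥ x = 0}
  zero_mem' := by simp
  add_mem' := by
    intro a b ha hb y hy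
    rw [dotProduct_add, ha y hy, hb y hy, add_zero]
  smul_mem' := by
    intro k a ha y hy
    rw [dotProduct_smul, ha y hy, smul_zero]

/-- The point `q ∈ RP²` and the line `p ∈ RP²*` are incident: `p q = 0`. -/
def Incident (q p : Plane) : Prop := q.submodule ≤ ann p.submodule

/-- A projective contact element `(q, p, ψ)` between `RP²` and `RP²*`: a non-incident pair `(q, p)`
and a linear isomorphism `ψ : T_q RP² → T_p RP²*` that covers the projective isomorphism
`Ψ_{q,p} : ℙ(T_q RP²) → ℙ(T_p RP²*)`, which sends a line `ℓ` through `q` to its intersection point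
`ℓ*` with the line `p`.  Here `v ≠ 0` in `T_q RP²` stands for the line `lineOf v` through `q`,
and `w ≠ 0` in `T_p RP²*` stands for the point on the line `p` to which the line in `RP²*` through
`p` and tangent to `w` is dual. -/
structure PC where
  q : Plane
  p : Plane
  nonincident : ¬ Incident q p
  ψ : Tang q ≃ₗ[ℝ] Tang p
  contact : ∀ v : Tang q, v ≠ 0 → ann (lineOf (ψ v)) = lineOf v ⊓ ann p.submodule

/-- Smoothness on `I` of a parametrized curve `(q(t), p(t), ψ(t))` of projective contact elements:
`q`, `p` are smooth, and `ψ` maps smooth vector fields along `q` to smooth vector fields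
along `p`. -/
def PC.SmoothCurveOn (c : ℝ → PC) (I : Set ℝ) : Prop :=
  ProjRolling.SmoothCurveOn (fun t => (c t).q) I ∧
  ProjRolling.SmoothCurveOn (fun t => (c t).p) I ∧
  ∀ t ∈ I, ∀ w : ∀ s, Tang (c s).q, SmoothFieldAt (fun s => (c s).q) w t →
    SmoothFieldAt (fun s => (c s).p) (fun s => (c s).ψ (w s)) t

/-- The no-slip condition `ψ(t) q'(t) = p'(t)`. -/
def NoSlip (c : ℝ → PC) (I : Set ℝ) : Prop :=
  ∀ t ∈ I, ∃ v : Tang (c t).q, HasVelocityAt (fun s => (c s).q) t v ∧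
    HasVelocityAt (fun s => (c s).p) t ((c t).ψ v)

/-- The no-twist condition: if `u(t)` is a parallel section of `ℙ(T RP²)` along `q(t)`, then
`ψ(t) u(t)` is a parallel section of `ℙ(T RP²*)` along `p(t)`. -/
def NoTwist (c : ℝ → PC) (I : Set ℝ) : Prop :=
  ∀ u : ∀ t, ℙ ℝ (Tang (c t).q), IsParallel (fun t => (c t).q) u I →
    IsParallel (fun t => (c t).p)
      (fun t => Projectivization.map ((c t).ψ : Tang (c t).q →ₗ[ℝ] Tang (c t).p)
        (c t).ψ.injective (u t)) I

/-- `(q, p) ∈ Q⁵` corresponds to the projective contact element `([q], [p], ψ)` with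
`ψ(dπ_q(X)) = dπ_p(q × X)` for all `X ∈ ℝ³`. -/
def Corresponds (x : Q5) (e : PC) : Prop :=
  e.q = Projectivization.mk ℝ x.vec x.vec_ne_zero ∧
  e.p = Projectivization.mk ℝ x.cov x.cov_ne_zero ∧
  ∀ (X : R3) (v : Tang e.q), IsDPi x.vec X v →
    IsDPi x.cov (crossProduct x.vec X) (e.ψ v)

end ProjRolling

namespace ProjRolling


/-! ### Vector algebra in `ℝ³` -/

/-! Bijection. Given `(q, p, ψ)`, choose `a` on `q` and `b` on `p` with `b · a = 1`, which
non-incidence allows. The contact condition says that `ψ` agrees with `X ↦ a × X` on directions, so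
the two differ by one scalar `k ≠ 0` (`PC.exists_factor`). Replacing `(a, b)` by `(αa, α⁻¹b)`
divides `k` by `α³`; hence exactly one real rescaling gives `k = 1`. The same cube settles
smoothness: `α³` is read off from `ψ`, and a function with smooth nonvanishing cube is smooth.

No-slip. Since `T_p` is `ℝ³ / p`, the condition reads `p' = q × q' + l p` for a function `l`, and
`Γ` is integral exactly when `l = 0`. So, given no-slip, no-twist has to be equivalent to `l = 0`.

No-twist. Write `q''' = a q + b q' + c q''`. In the frame `q, q', q''` the osculating conic and the
development equation involve only `b` and `c` (`onOsculatingConic_iff`, `exists_velocity_iff`).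
Parametrizing the conic by the slope `s = m / n` of the line to the contact point turns developments
into the Riccati equation `s' = s²/2 + (2c/3) s + (-b/2 - c'/6 + c²/18)`. The dual curve has the
same `c`, with `b + 3l' - cl` in place of `b` (`exists_dual_frame`), and `ψ` sends slope `s` to `s -
l` (`cross_comb`).

If `l = 0`, the two descriptions coincide and parallel sections go to parallel sections. Conversely,
subtracting the Riccati equations of `s` and `s - l` leaves `l s = l²/2 - cl/6 - l'/2`
(`riccati_compare`). Parallel sections on all of `I` exist with any slope at any moment, so this
holds for every real `s`, and `l = 0`. -/

theorem linearIndependent_iff_triple (u v w : R3) :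
    LinearIndependent ℝ ![u, v, w] ↔ u ⬝ᵥ v ⨯₃ w ≠ 0 := by
  rw [triple_product_eq_det, ← isUnit_iff_ne_zero]
  exact Matrix.linearIndependent_rows_iff_isUnit.trans
    (Matrix.isUnit_iff_isUnit_det (Matrix.of ![u, v, w]))

theorem dot_expand (u v : R3) : u ⬝ᵥ v = u 0 * v 0 + u 1 * v 1 + u 2 * v 2 := by
  simp [dotProduct, Fin.sum_univ_three]

theorem cross_apply_zero (u v : R3) : (u ⨯₃ v) 0 = u 1 * v 2 - u 2 * v 1 := by
  simp [cross_apply]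

theorem cross_apply_one (u v : R3) : (u ⨯₃ v) 1 = u 2 * v 0 - u 0 * v 2 := by
  simp [cross_apply]

theorem cross_apply_two (u v : R3) : (u ⨯₃ v) 2 = u 0 * v 1 - u 1 * v 0 := by
  simp [cross_apply]

theorem triple_expansion (p x y z : R3) :
    (p ⬝ᵥ x) • y ⨯₃ z + (p ⬝ᵥ y) • z ⨯₃ x + (p ⬝ᵥ z) • x ⨯₃ y = (x ⬝ᵥ y ⨯₃ z) • p := by
  ext i
  fin_cases i <;>
    simp only [Fin.zero_eta, Fin.mk_one, Fin.reduceFinMk, Pi.add_apply, Pi.smul_apply,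
      smul_eq_mul, dot_expand, cross_apply_zero, cross_apply_one, cross_apply_two] <;> ring

theorem cross_cross_dot (q p Y : R3) : q ⨯₃ (Y ⨯₃ p) = (p ⬝ᵥ q) • Y - (q ⬝ᵥ Y) • p := by
  ext i
  fin_cases i <;>
    simp only [Fin.zero_eta, Fin.mk_one, Fin.reduceFinMk, Pi.sub_apply, Pi.smul_apply,
      smul_eq_mul, dot_expand, cross_apply_zero, cross_apply_one, cross_apply_two] <;> ring

/-- Cramer's rule. -/
theorem cramer_expansion (x y z v : R3) :
    (v ⬝ᵥ y ⨯₃ z) • x + (v ⬝ᵥ z ⨯₃ x) • y + (v ⬝ᵥ x ⨯₃ y) • z = (x ⬝ᵥ y ⨯₃ z) • v := by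
  ext i
  fin_cases i <;>
    simp only [Fin.zero_eta, Fin.mk_one, Fin.reduceFinMk, Pi.add_apply, Pi.smul_apply,
      smul_eq_mul, dot_expand, cross_apply_zero, cross_apply_one, cross_apply_two] <;> ring

theorem cross_eq_zero_iff {a X : R3} (ha : a ≠ 0) : a ⨯₃ X = 0 ↔ ∃ k : ℝ, k • a = X := by
  rw [← not_iff_not, ← ne_eq, crossProduct_ne_zero_iff_linearIndependent,
    LinearIndependent.pair_iff' ha, not_exists]

/-! ### Points of the projective plane and tangent vectors -/

theorem submodule_eq_span {q : Plane} {a : R3} (ha : a ≠ 0) (h : a ∈ q.submodule) :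
    q.submodule = ℝ ∙ a := by
  induction q using Projectivization.ind with
  | h b hb =>
    rw [Projectivization.submodule_mk] at h ⊢
    obtain ⟨k, rfl⟩ := Submodule.mem_span_singleton.1 h
    have hk : k ≠ 0 := by rintro rfl; simp at ha
    exact (Submodule.span_singleton_smul_eq (IsUnit.mk0 k hk) b).symm

theorem eq_mk_of_mem {q : Plane} {a : R3} (ha : a ≠ 0) (h : a ∈ q.submodule) :
    q = Projectivization.mk ℝ a ha := by
  apply Projectivization.submodule_injective
  rw [submodule_eq_span ha h, Projectivization.submodule_mk]

theorem mem_iff_smul {q : Plane} {a b : R3} (ha : a ≠ 0) (h : a ∈ q.submodule) :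
    b ∈ q.submodule ↔ ∃ k : ℝ, k • a = b := by
  rw [submodule_eq_span ha h, Submodule.mem_span_singleton]

theorem mem_iff_cross {q : Plane} {a b : R3} (ha : a ≠ 0) (h : a ∈ q.submodule) :
    b ∈ q.submodule ↔ a ⨯₃ b = 0 := by
  rw [mem_iff_smul ha h, cross_eq_zero_iff ha]

theorem mem_mk_self (a : R3) (ha : a ≠ 0) : a ∈ (Projectivization.mk ℝ a ha).submodule := by
  rw [Projectivization.submodule_mk]
  exact Submodule.mem_span_singleton_self a

/-- Evaluation at a nonzero vector `a` of `q` identifies `T_q` with `ℝ³ / q`. -/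
noncomputable def evalEquiv {q : Plane} {a : R3} (ha : a ≠ 0) (h : a ∈ q.submodule) :
    Tang q ≃ₗ[ℝ] (R3 ⧸ q.submodule) :=
  (LinearEquiv.arrowCongr ((LinearEquiv.toSpanNonzeroSingleton ℝ R3 a ha).trans
    (LinearEquiv.ofEq _ _ (submodule_eq_span ha h).symm)).symm (LinearEquiv.refl ℝ _)).trans
    (LinearMap.ringLmapEquivSelf ℝ ℝ _)

theorem evalEquiv_apply {q : Plane} {a : R3} (ha : a ≠ 0) (h : a ∈ q.submodule) (v : Tang q) :
    evalEquiv ha h v = v ⟨a, h⟩ := by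
  simp only [evalEquiv, LinearEquiv.trans_apply, LinearMap.ringLmapEquivSelf_apply,
    LinearEquiv.arrowCongr_apply, LinearEquiv.refl_apply, LinearEquiv.symm_symm]
  congr 1
  ext1
  simp

theorem isDPi_iff {q : Plane} {a X : R3} (ha : a ≠ 0) (h : a ∈ q.submodule) (v : Tang q) :
    IsDPi a X v ↔ evalEquiv ha h v = Submodule.Quotient.mk X := by
  rw [evalEquiv_apply]
  exact ⟨fun ⟨_, _, h⟩ => h, fun h' => ⟨ha, h, h'⟩⟩

theorem IsDPi.ne_zero {q : Plane} {a X : R3} {v : Tang q} (h : IsDPi a X v) : a ≠ 0 := h.1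

theorem IsDPi.mem {q : Plane} {a X : R3} {v : Tang q} (h : IsDPi a X v) : a ∈ q.submodule := h.2.1

theorem exists_isDPi {q : Plane} {a : R3} (ha : a ≠ 0) (h : a ∈ q.submodule) (X : R3) :
    ∃ v : Tang q, IsDPi a X v :=
  ⟨(evalEquiv ha h).symm (Submodule.Quotient.mk X), by rw [isDPi_iff ha h]; simp⟩

theorem exists_isDPi_right {q : Plane} {a : R3} (ha : a ≠ 0) (h : a ∈ q.submodule) (v : Tang q) :
    ∃ X, IsDPi a X v := by
  obtain ⟨X, hX⟩ := Submodule.Quotient.mk_surjective _ (evalEquiv ha h v)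
  exact ⟨X, (isDPi_iff ha h v).2 hX.symm⟩

theorem IsDPi.unique {q : Plane} {a X : R3} {v w : Tang q} (hv : IsDPi a X v) (hw : IsDPi a X w) :
    v = w := by
  have h0 := hv.ne_zero
  have h1 := hv.mem
  rw [isDPi_iff h0 h1] at hv hw
  exact (evalEquiv h0 h1).injective (hv.trans hw.symm)

/-- The kernel of `dπ_a` is the line spanned by `a`. -/
theorem IsDPi.congr_iff {q : Plane} {a X Y : R3} {v : Tang q} (hv : IsDPi a X v) :
    IsDPi a Y v ↔ ∃ k : ℝ, Y = X + k • a := by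
  have hv' := hv
  rw [isDPi_iff hv.ne_zero hv.mem] at hv' ⊢
  rw [hv', eq_comm, Submodule.Quotient.eq, mem_iff_smul hv.ne_zero hv.mem]
  refine exists_congr fun k => ?_
  rw [eq_comm, sub_eq_iff_eq_add, add_comm]

/-- An element of `Hom(q, ℝ³ / q)` is linear in the point of `q`. This is the rule for changing
lifts. -/
theorem IsDPi.smul {q : Plane} {a X : R3} {v : Tang q} (hv : IsDPi a X v) {k : ℝ} (hk : k ≠ 0) :
    IsDPi (k • a) (k • X) v := by
  obtain ⟨h0, h1, h2⟩ := hv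
  refine ⟨smul_ne_zero hk h0, Submodule.smul_mem _ k h1, ?_⟩
  rw [Submodule.Quotient.mk_smul, ← h2, ← map_smul]
  rfl

theorem IsDPi.const_smul {q : Plane} {a X : R3} {v : Tang q} (hv : IsDPi a X v) (k : ℝ) :
    IsDPi a (k • X) (k • v) := by
  obtain ⟨h0, h1, h2⟩ := hv
  refine ⟨h0, h1, ?_⟩
  rw [Submodule.Quotient.mk_smul, ← h2]
  rfl

theorem IsDPi.eq_zero_iff {q : Plane} {a X : R3} {v : Tang q} (hv : IsDPi a X v) :
    v = 0 ↔ a ⨯₃ X = 0 := by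
  have hv' := hv
  rw [isDPi_iff hv.ne_zero hv.mem] at hv'
  rw [← (evalEquiv hv.ne_zero hv.mem).map_eq_zero_iff, hv', Submodule.Quotient.mk_eq_zero,
    mem_iff_cross hv.ne_zero hv.mem]

theorem IsDPi.mem_lineOf {q : Plane} {a X y : R3} {v : Tang q} (hv : IsDPi a X v) :
    y ∈ lineOf v ↔ ∃ k l : ℝ, y = k • a + l • X := by
  obtain ⟨h0, h1, h2⟩ := hv
  rw [lineOf, Submodule.mem_comap, LinearMap.mem_range]
  constructor
  · rintro ⟨⟨w, hw⟩, h⟩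
    obtain ⟨l, rfl⟩ := (mem_iff_smul h0 h1).1 hw
    have : v ⟨l • a, hw⟩ = l • Submodule.Quotient.mk X := by
      rw [← h2, ← map_smul]; rfl
    rw [this, Submodule.mkQ_apply, ← Submodule.Quotient.mk_smul, eq_comm, Submodule.Quotient.eq,
      mem_iff_smul h0 h1] at h
    obtain ⟨k, hk⟩ := h
    exact ⟨k, l, by rw [hk]; simp⟩
  · rintro ⟨k, l, rfl⟩
    refine ⟨l • ⟨a, h1⟩, ?_⟩
    rw [map_smul, h2, ← Submodule.Quotient.mk_smul, Submodule.mkQ_apply, Submodule.Quotient.eq,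
      mem_iff_smul h0 h1]
    exact ⟨-k, by simp⟩

theorem IsDPi.lineOf_eq {q : Plane} {a X : R3} {v : Tang q} (hv : IsDPi a X v) :
    lineOf v = Submodule.span ℝ {a, X} := by
  ext y
  rw [hv.mem_lineOf, Submodule.mem_span_pair]
  simp only [eq_comm]

theorem lineOf_smul {q : Plane} (v : Tang q) {k : ℝ} (hk : k ≠ 0) : lineOf (k • v) = lineOf v := by
  obtain ⟨X, hX⟩ := exists_isDPi_right q.rep_nonzero
    (by rw [q.submodule_eq]; exact Submodule.mem_span_singleton_self _) v
  ext y
  rw [(hX.const_smul k).mem_lineOf, hX.mem_lineOf]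
  refine exists_congr fun c => ⟨fun ⟨l, h⟩ => ⟨l * k, by rw [h, smul_smul]⟩,
    fun ⟨l, h⟩ => ⟨l / k, by rw [h, smul_smul, div_mul_cancel₀ _ hk]⟩⟩

theorem rep_mem (q : Plane) : q.rep ∈ q.submodule := by
  rw [q.submodule_eq]; exact Submodule.mem_span_singleton_self _

theorem lineOf_mk_rep {q : Plane} (v : Tang q) (hv : v ≠ 0) :
    lineOf (Projectivization.mk ℝ v hv).rep = lineOf v := by
  obtain ⟨a, ha⟩ := Projectivization.exists_smul_eq_mk_rep ℝ v hv
  rw [← ha]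
  exact lineOf_smul v a.ne_zero

theorem IsDPi.add {q : Plane} {a X Y : R3} {v w : Tang q} (hv : IsDPi a X v) (hw : IsDPi a Y w) :
    IsDPi a (X + Y) (v + w) := by
  obtain ⟨h0, h1, h2⟩ := hv
  obtain ⟨_, _, h3⟩ := hw
  exact ⟨h0, h1, by rw [Submodule.Quotient.mk_add, ← h2, ← h3]; rfl⟩

/-- A tangent vector at `q = [a]` has only one representative in the kernel of a linear form that
does not vanish on `a`. -/
theorem IsDPi.eq_of_dot {q : Plane} {a b X Y : R3} {v : Tang q} (hX : IsDPi a X v)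
    (hY : IsDPi a Y v) (hab : a ⬝ᵥ b ≠ 0) (h : X ⬝ᵥ b = Y ⬝ᵥ b) : X = Y := by
  obtain ⟨k, rfl⟩ := hX.congr_iff.1 hY
  rw [add_dotProduct, smul_dotProduct, smul_eq_mul] at h
  have : k = 0 := by
    have : k * (a ⬝ᵥ b) = 0 := by linarith
    exact (mul_eq_zero.1 this).resolve_right hab
  simp [this]


/-! ### The bijection between `Q⁵` and the space of projective contact elements -/

theorem Q5.cov_dot_vec (x : Q5) : x.cov ⬝ᵥ x.vec = 1 := x.2

theorem dot_self_pos {a : R3} (ha : a ≠ 0) : a ⬝ᵥ a ≠ 0 := by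
  simpa using ha

theorem exists_cross_ne_zero {a : R3} (ha : a ≠ 0) : ∃ X, a ⨯₃ X ≠ 0 := by
  by_contra! h
  apply ha
  have h1 := fun i => congrFun (h (Pi.single 1 1)) i
  have h2 := fun i => congrFun (h (Pi.single 2 1)) i
  have e0 := h1 2
  have e1 := h2 0
  have e2 := h1 0
  rw [cross_apply_two] at e0
  rw [cross_apply_zero] at e1 e2
  ext i
  fin_cases i <;> simp_all

/-- The plane orthogonal to `a × X` is spanned by `a` and `X`. -/
theorem exists_combination_of_dot_cross {a X y : R3} (h : a ⨯₃ X ≠ 0) (hy : (a ⨯₃ X) ⬝ᵥ y = 0) :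
    ∃ k l : ℝ, y = k • a + l • X := by
  have hn := dot_self_pos h
  have := cramer_expansion a X (a ⨯₃ X) y
  rw [dotProduct_comm y (a ⨯₃ X), hy, zero_smul, add_zero, triple_product_permutation a,
    triple_product_permutation X (a ⨯₃ X)] at this
  refine ⟨((a ⨯₃ X) ⬝ᵥ (a ⨯₃ X))⁻¹ * (y ⬝ᵥ X ⨯₃ (a ⨯₃ X)),
    ((a ⨯₃ X) ⬝ᵥ (a ⨯₃ X))⁻¹ * (y ⬝ᵥ (a ⨯₃ X) ⨯₃ a), ?_⟩
  rw [mul_smul, mul_smul, ← smul_add, this, smul_smul, inv_mul_cancel₀ hn, one_smul]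

theorem mem_ann_lineOf {p : Plane} {b Y y : R3} {w : Tang p} (hw : IsDPi b Y w) :
    y ∈ ann (lineOf w) ↔ b ⬝ᵥ y = 0 ∧ Y ⬝ᵥ y = 0 := by
  constructor
  · intro h
    exact ⟨h b (hw.mem_lineOf.2 ⟨1, 0, by simp⟩), h Y (hw.mem_lineOf.2 ⟨0, 1, by simp⟩)⟩
  · rintro ⟨h1, h2⟩ z hz
    obtain ⟨k, l, rfl⟩ := hw.mem_lineOf.1 hz
    simp [add_dotProduct, smul_dotProduct, h1, h2]

theorem mem_ann_submodule {p : Plane} {b y : R3} (hb : b ≠ 0) (h : b ∈ p.submodule) :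
    y ∈ ann p.submodule ↔ b ⬝ᵥ y = 0 := by
  constructor
  · exact fun hy => hy b h
  · intro hy z hz
    obtain ⟨k, rfl⟩ := (mem_iff_smul hb h).1 hz
    simp [smul_dotProduct, hy]

/-- The contact condition for `X ↦ a × X`: being orthogonal to `a × X` means lying in the plane of
`a` and `X`, and being orthogonal to `b` means lying on the line `p`. -/
theorem ann_lineOf_cross {q p : Plane} {a b X : R3} {v : Tang q} {w : Tang p} (hv : IsDPi a X v)
    (hw : IsDPi b (a ⨯₃ X) w) (h0 : v ≠ 0) : ann (lineOf w) = lineOf v ⊓ ann p.submodule := by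
  have hX : a ⨯₃ X ≠ 0 := fun h => h0 (hv.eq_zero_iff.2 h)
  ext y
  rw [Submodule.mem_inf, mem_ann_lineOf hw, mem_ann_submodule hw.ne_zero hw.mem, hv.mem_lineOf,
    and_comm]
  refine and_congr_left fun _ => ⟨exists_combination_of_dot_cross hX, ?_⟩
  rintro ⟨k, l, rfl⟩
  rw [dotProduct_comm]
  simp [add_dotProduct, smul_dotProduct, dot_self_cross, dot_cross_self]

/-- The isomorphism `X ↦ q × X` from `ℝ³ / q` to `(ℝ³)* / p`. -/
noncomputable def Q5.crossEquiv (x : Q5) :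
    (R3 ⧸ (Projectivization.mk ℝ x.vec x.vec_ne_zero).submodule) ≃ₗ[ℝ]
      (R3 ⧸ (Projectivization.mk ℝ x.cov x.cov_ne_zero).submodule) :=
  LinearEquiv.ofBijective
    (Submodule.mapQ _ _ (crossProduct x.vec) (by
      intro y hy
      rw [mem_iff_cross x.vec_ne_zero (mem_mk_self _ _)] at hy
      rw [Submodule.mem_comap, hy]
      exact Submodule.zero_mem _))
    (by
      constructor
      · rw [← LinearMap.ker_eq_bot, LinearMap.ker_eq_bot']
        intro m hm
        obtain ⟨X, rfl⟩ := Submodule.Quotient.mk_surjective _ m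
        rw [Submodule.mapQ_apply, Submodule.Quotient.mk_eq_zero,
          mem_iff_smul x.cov_ne_zero (mem_mk_self _ _)] at hm
        obtain ⟨k, hk⟩ := hm
        -- If `q × X = k p`, pairing with `q` gives `k = 0`.
        have := congrArg (fun y => y ⬝ᵥ x.vec) hk
        simp only [smul_dotProduct, x.cov_dot_vec, smul_eq_mul, mul_one] at this
        rw [dotProduct_comm, dot_self_cross] at this
        rw [this, zero_smul] at hk
        rw [Submodule.Quotient.mk_eq_zero, mem_iff_cross x.vec_ne_zero (mem_mk_self _ _), ← hk]
      · intro m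
        obtain ⟨Y, rfl⟩ := Submodule.Quotient.mk_surjective _ m
        -- By the double cross product, `q × (Y × p) = Y - (q · Y) p`, which is `Y` modulo `p`.
        refine ⟨Submodule.Quotient.mk (Y ⨯₃ x.cov), ?_⟩
        rw [Submodule.mapQ_apply, Submodule.Quotient.eq, cross_cross_dot, x.cov_dot_vec, one_smul,
          mem_iff_smul x.cov_ne_zero (mem_mk_self _ _)]
        exact ⟨-(x.vec ⬝ᵥ Y), by simp⟩)

theorem Q5.crossEquiv_mk (x : Q5) (X : R3) :
    x.crossEquiv (Submodule.Quotient.mk X) = Submodule.Quotient.mk (x.vec ⨯₃ X) := rfl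

/-- The isomorphism `ψ` of tangent spaces that belongs to a point of `Q⁵`. -/
noncomputable def Q5.tangEquiv (x : Q5) :
    Tang (Projectivization.mk ℝ x.vec x.vec_ne_zero) ≃ₗ[ℝ]
      Tang (Projectivization.mk ℝ x.cov x.cov_ne_zero) :=
  ((evalEquiv x.vec_ne_zero (mem_mk_self _ _)).trans x.crossEquiv).trans
    (evalEquiv x.cov_ne_zero (mem_mk_self _ _)).symm

theorem Q5.tangEquiv_isDPi (x : Q5) {X : R3}
    {v : Tang (Projectivization.mk ℝ x.vec x.vec_ne_zero)} (hv : IsDPi x.vec X v) :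
    IsDPi x.cov (x.vec ⨯₃ X) (x.tangEquiv v) := by
  rw [isDPi_iff x.vec_ne_zero (mem_mk_self _ _)] at hv
  rw [isDPi_iff x.cov_ne_zero (mem_mk_self _ _), Q5.tangEquiv, LinearEquiv.trans_apply,
    LinearEquiv.apply_symm_apply, LinearEquiv.trans_apply, hv, crossEquiv_mk]

/-- The projective contact element of a point of `Q⁵`. -/
noncomputable def Q5.toPC (x : Q5) : PC where
  q := Projectivization.mk ℝ x.vec x.vec_ne_zero
  p := Projectivization.mk ℝ x.cov x.cov_ne_zero
  nonincident h := by
    have := (mem_ann_submodule x.cov_ne_zero (mem_mk_self _ _)).1 (h (mem_mk_self _ x.vec_ne_zero))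
    rw [x.cov_dot_vec] at this
    exact one_ne_zero this
  ψ := x.tangEquiv
  contact v hv := by
    obtain ⟨X, hX⟩ := exists_isDPi_right x.vec_ne_zero (mem_mk_self _ _) v
    exact ann_lineOf_cross hX (x.tangEquiv_isDPi hX) hv

theorem Q5.corresponds_toPC (x : Q5) : Corresponds x x.toPC :=
  ⟨rfl, rfl, fun _ _ hv => x.tangEquiv_isDPi hv⟩

theorem Corresponds.vec_mem {x : Q5} {e : PC} (h : Corresponds x e) : x.vec ∈ e.q.submodule := by
  rw [h.1]; exact mem_mk_self _ _

theorem Corresponds.cov_mem {x : Q5} {e : PC} (h : Corresponds x e) : x.cov ∈ e.p.submodule := by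
  rw [h.2.1]; exact mem_mk_self _ _

theorem Corresponds.right_unique {x : Q5} {e f : PC} (he : Corresponds x e)
    (hf : Corresponds x f) : e = f := by
  obtain ⟨q, p, _, ψ, _⟩ := e
  obtain ⟨q', p', _, ψ', _⟩ := f
  obtain ⟨h1, h2, h3⟩ := he
  obtain ⟨h1', h2', h3'⟩ := hf
  dsimp only at h1 h2 h3 h1' h2' h3'
  subst h1 h2 h1' h2'
  congr 1
  ext1 v
  obtain ⟨X, hX⟩ := exists_isDPi_right x.vec_ne_zero (mem_mk_self _ _) v
  exact (h3 X v hX).unique (h3' X v hX)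

/-- Two points over `e` differ by factors `(α, β)` with `βα = 1`. Evaluating `ψ` through both gives
`β = α²`, so `α³ = 1`, and `1` is the only real cube root of `1`. -/
theorem Corresponds.left_unique {x y : Q5} {e : PC} (hx : Corresponds x e)
    (hy : Corresponds y e) : x = y := by
  obtain ⟨α, hα⟩ := (mem_iff_smul x.vec_ne_zero hx.vec_mem).1 hy.vec_mem
  obtain ⟨β, hβ⟩ := (mem_iff_smul x.cov_ne_zero hx.cov_mem).1 hy.cov_mem
  have hαβ : β * α = 1 := by
    have := y.cov_dot_vec
    rwa [← hα, ← hβ, smul_dotProduct, dotProduct_smul, x.cov_dot_vec, smul_eq_mul, smul_eq_mul,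
      mul_one] at this
  have hα0 : α ≠ 0 := right_ne_zero_of_mul_eq_one hαβ
  have hβ0 : β ≠ 0 := left_ne_zero_of_mul_eq_one hαβ
  obtain ⟨X, hX⟩ := exists_cross_ne_zero x.vec_ne_zero
  obtain ⟨v, hv⟩ := exists_isDPi x.vec_ne_zero hx.vec_mem X
  have h1 := (hx.2.2 X v hv).smul hβ0
  have hv' := hv.smul hα0
  rw [hα] at hv'
  have h2 := hy.2.2 _ v hv'
  rw [hβ] at h1
  -- Both representatives of `ψ v` annihilate `y.vec`, so they are equal and not only congruent
  -- modulo `y.cov`.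
  have h3 := h1.eq_of_dot h2 (b := y.vec) (by rw [y.cov_dot_vec]; exact one_ne_zero) (by
    rw [dotProduct_comm (y.vec ⨯₃ _), dot_self_cross, ← hα, smul_dotProduct, dotProduct_smul,
      dotProduct_comm (x.vec ⨯₃ _), dot_self_cross, smul_zero, smul_zero])
  rw [← hα, map_smul, map_smul, LinearMap.smul_apply, smul_smul, ← sub_eq_zero, ← sub_smul,
    smul_eq_zero] at h3
  have h4 : β - α * α = 0 := h3.resolve_right hX
  have h5 : α = 1 := by
    have : (α - 1) * (α ^ 2 + α + 1) = 0 := by linear_combination hαβ - α * h4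
    rcases mul_eq_zero.1 this with h | h
    · linarith
    · nlinarith [sq_nonneg (α + 1 / 2)]
  have h6 : β = 1 := by rw [h5, mul_one] at hαβ; exact hαβ
  apply Subtype.ext
  refine Prod.ext ?_ ?_
  · change x.vec = y.vec
    rw [← hα, h5, one_smul]
  · change x.cov = y.cov
    rw [← hβ, h6, one_smul]

theorem exists_cube_root (k : ℝ) : ∃ α : ℝ, α ^ 3 = k := by
  have h : ∀ k : ℝ, 0 ≤ k → ∃ α : ℝ, α ^ 3 = k := fun k hk =>
    ⟨k ^ ((3 : ℕ) : ℝ)⁻¹, Real.rpow_inv_natCast_pow hk three_ne_zero⟩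
  rcases le_total 0 k with hk | hk
  · exact h k hk
  · obtain ⟨α, hα⟩ := h (-k) (by linarith)
    exact ⟨-α, by rw [Odd.neg_pow (by decide), hα, neg_neg]⟩

/-- The linear isomorphism of a projective contact element is determined up to a factor. -/
theorem PC.exists_factor_apply (e : PC) {a b X : R3} {v : Tang e.q} (hv : IsDPi a X v) (hb : b ≠ 0)
    (hbp : b ∈ e.p.submodule) (hba : b ⬝ᵥ a = 1) : ∃ k : ℝ, IsDPi b (k • a ⨯₃ X) (e.ψ v) := by
  by_cases hv0 : v = 0
  · refine ⟨0, ?_⟩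
    subst hv0
    rw [map_zero, zero_smul]
    exact ⟨hb, hbp, by simp⟩
  have hX : a ⨯₃ X ≠ 0 := fun h => hv0 (hv.eq_zero_iff.2 h)
  obtain ⟨Z, hZ⟩ := exists_isDPi_right hb hbp (e.ψ v)
  -- The representative is normalized to annihilate `a`.
  have hY : IsDPi b (Z - (Z ⬝ᵥ a) • b) (e.ψ v) :=
    hZ.congr_iff.2 ⟨-(Z ⬝ᵥ a), by rw [neg_smul, sub_eq_add_neg]⟩
  set Y := Z - (Z ⬝ᵥ a) • b with hYdef
  have hYa : Y ⬝ᵥ a = 0 := by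
    rw [hYdef, sub_dotProduct, smul_dotProduct, hba]; simp
  -- This vector is the point where the line through `a` and `X` meets `p`. The contact condition
  -- makes `Y` annihilate it, hence also `X`; so `Y` is parallel to `a × X`.
  have hy : X - (b ⬝ᵥ X) • a ∈ ann (lineOf (e.ψ v)) := by
    rw [e.contact v hv0, Submodule.mem_inf, hv.mem_lineOf, mem_ann_submodule hb hbp]
    refine ⟨⟨-(b ⬝ᵥ X), 1, by simp [sub_eq_add_neg, add_comm]⟩, ?_⟩
    rw [dotProduct_sub, dotProduct_smul, hba]; simp
  have hYX : Y ⬝ᵥ X = 0 := by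
    have := ((mem_ann_lineOf hY).1 hy).2
    rwa [dotProduct_sub, dotProduct_smul, hYa, smul_zero, sub_zero] at this
  have hcr : (a ⨯₃ X) ⨯₃ Y = 0 := by
    have h1 := cross_cross_dot Y X a
    rw [dotProduct_comm X Y, hYX, hYa, zero_smul, zero_smul, sub_zero] at h1
    rw [← cross_anticomm, h1, neg_zero]
  obtain ⟨k, hk⟩ := (cross_eq_zero_iff hX).1 hcr
  exact ⟨k, hk ▸ hY⟩

/-- A linear map that multiplies each vector by some factor is a scalar. The factors are compared on
`X`, `n = a × X` and `X + n`, where `a, X, n` is a basis. -/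
theorem PC.exists_factor (e : PC) {a b : R3} (ha : a ≠ 0) (haq : a ∈ e.q.submodule) (hb : b ≠ 0)
    (hbp : b ∈ e.p.submodule) (hba : b ⬝ᵥ a = 1) :
    ∃ k : ℝ, ∀ (X : R3) (v : Tang e.q), IsDPi a X v → IsDPi b (k • a ⨯₃ X) (e.ψ v) := by
  obtain ⟨X, hX⟩ := exists_cross_ne_zero ha
  set n := a ⨯₃ X with hn
  have han : a ⬝ᵥ n = 0 := dot_self_cross a X
  have hm : a ⨯₃ n ≠ 0 := by
    intro h
    obtain ⟨k, hk⟩ := (cross_eq_zero_iff ha).1 h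
    rw [← hk, dotProduct_smul, smul_eq_mul, mul_eq_zero] at han
    rcases han with h | h
    · rw [h, zero_smul] at hk; exact hX hk.symm
    · exact dot_self_pos ha h
  have hdot : ∀ (k : ℝ) (Y : R3), (k • a ⨯₃ Y) ⬝ᵥ a = 0 := fun k Y => by
    rw [smul_dotProduct, dotProduct_comm, dot_self_cross, smul_zero]
  have hba' : b ⬝ᵥ a ≠ 0 := by rw [hba]; exact one_ne_zero
  obtain ⟨v, hv⟩ := exists_isDPi ha haq X
  obtain ⟨w, hw⟩ := exists_isDPi ha haq n
  obtain ⟨k, hk⟩ := e.exists_factor_apply hv hb hbp hba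
  obtain ⟨l, hl⟩ := e.exists_factor_apply hw hb hbp hba
  obtain ⟨m, hm'⟩ := e.exists_factor_apply (hv.add hw) hb hbp hba
  have h1 := hk.add hl
  rw [← map_add] at h1
  have h2 := hm'.eq_of_dot h1 hba' (by rw [add_dotProduct, hdot, hdot, hdot, add_zero])
  rw [map_add, ← hn, smul_add] at h2
  have h3 : m = k := by
    have := congrArg (fun y => n ⬝ᵥ y) h2
    simp only [dotProduct_add, dotProduct_smul, dot_cross_self, mul_zero, add_zero,
      smul_eq_mul] at this
    exact mul_right_cancel₀ (dot_self_pos hX) this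
  have h4 : l = k := by
    rw [h3, add_right_inj, ← sub_eq_zero, ← sub_smul, smul_eq_zero] at h2
    have := h2.resolve_right hm
    linarith
  subst h4
  refine ⟨l, fun Y u hu => ?_⟩
  obtain ⟨r, s, t, hY⟩ : ∃ r s t : ℝ, Y = r • a + (s • X + t • n) := by
    have hD : a ⬝ᵥ X ⨯₃ n ≠ 0 := by
      rw [triple_product_permutation, triple_product_permutation, ← hn]
      exact dot_self_pos hX
    have := cramer_expansion a X n Y
    refine ⟨(a ⬝ᵥ X ⨯₃ n)⁻¹ * (Y ⬝ᵥ X ⨯₃ n), (a ⬝ᵥ X ⨯₃ n)⁻¹ * (Y ⬝ᵥ n ⨯₃ a),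
      (a ⬝ᵥ X ⨯₃ n)⁻¹ * (Y ⬝ᵥ a ⨯₃ X), ?_⟩
    rw [mul_smul, mul_smul, mul_smul, ← smul_add, ← smul_add, ← add_assoc, this, smul_smul,
      inv_mul_cancel₀ hD, one_smul]
  have hu' := (hv.const_smul s).add (hw.const_smul t)
  have h5 : u = s • v + t • w := by
    refine IsDPi.unique hu (hu'.congr_iff.2 ⟨r, ?_⟩)
    rw [hY, add_comm]
  have h6 := (hk.const_smul s).add (hl.const_smul t)
  have h7 : l • a ⨯₃ Y = s • l • a ⨯₃ X + t • l • a ⨯₃ n := by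
    rw [hY, map_add, map_add, map_smul, map_smul, map_smul, cross_self, smul_zero, zero_add,
      smul_add, smul_comm l s, smul_comm l t]
  rw [h7, h5, map_add, map_smul, map_smul]
  exact h6

/-- Passing from `(a, b)` to `(αa, α⁻¹b)` keeps the pairing equal to `1` and divides the factor `k`
by `α³`, so a real cube root of `k` normalizes it. -/
theorem Corresponds.exists_left (e : PC) : ∃ x : Q5, Corresponds x e := by
  set a := e.q.rep with ha_def
  have ha : a ≠ 0 := e.q.rep_nonzero
  have haq : a ∈ e.q.submodule := rep_mem _
  have h0 : e.p.rep ⬝ᵥ a ≠ 0 := by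
    intro h
    apply e.nonincident
    intro y hy
    obtain ⟨k, rfl⟩ := (mem_iff_smul ha haq).1 hy
    rw [mem_ann_submodule e.p.rep_nonzero (rep_mem _), dotProduct_smul, h, smul_zero]
  set b := (e.p.rep ⬝ᵥ a)⁻¹ • e.p.rep with hb_def
  have hb : b ≠ 0 := smul_ne_zero (inv_ne_zero h0) e.p.rep_nonzero
  have hbp : b ∈ e.p.submodule := Submodule.smul_mem _ _ (rep_mem _)
  have hba : b ⬝ᵥ a = 1 := by
    rw [hb_def, smul_dotProduct, smul_eq_mul, inv_mul_cancel₀ h0]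
  obtain ⟨k, hk⟩ := e.exists_factor ha haq hb hbp hba
  -- A zero factor would contradict the injectivity of `ψ`.
  have hk0 : k ≠ 0 := by
    rintro rfl
    obtain ⟨X, hX⟩ := exists_cross_ne_zero ha
    obtain ⟨v, hv⟩ := exists_isDPi ha haq X
    have h1 := hk X v hv
    rw [zero_smul] at h1
    have h2 := h1.eq_zero_iff.2 (by simp)
    rw [LinearEquiv.map_eq_zero_iff] at h2
    exact hX (hv.eq_zero_iff.1 h2)
  obtain ⟨α, hα⟩ := exists_cube_root k
  have hα0 : α ≠ 0 := by
    rintro rfl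
    exact hk0 (by rw [← hα]; norm_num)
  let x : Q5 := ⟨(α • a, α⁻¹ • b), by
    change (α⁻¹ • b) ⬝ᵥ (α • a) = 1
    rw [smul_dotProduct, dotProduct_smul, hba, smul_eq_mul, smul_eq_mul, mul_one,
      inv_mul_cancel₀ hα0]⟩
  have hxv : x.vec = α • a := rfl
  have hxc : x.cov = α⁻¹ • b := rfl
  refine ⟨x, eq_mk_of_mem _ (Submodule.smul_mem _ _ haq), eq_mk_of_mem _
    (Submodule.smul_mem _ _ hbp), fun X v hv => ?_⟩
  rw [hxv] at hv ⊢
  rw [hxc]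
  have h1 := hv.smul (inv_ne_zero hα0)
  rw [smul_smul, inv_mul_cancel₀ hα0, one_smul] at h1
  have h2 := (hk _ v h1).smul (inv_ne_zero hα0)
  convert h2 using 1
  rw [map_smul, LinearMap.smul_apply, map_smul, smul_smul, smul_smul, ← hα]
  congr 1
  field_simp

/-- The bijection of `Q⁵` with the space of projective contact elements. -/
noncomputable def contactEquiv : Q5 ≃ PC :=
  Equiv.ofBijective Q5.toPC
    ⟨fun x _ h => x.corresponds_toPC.left_unique (h ▸ Q5.corresponds_toPC _), fun e => by
      obtain ⟨x, hx⟩ := Corresponds.exists_left e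
      exact ⟨x, x.corresponds_toPC.right_unique hx⟩⟩

theorem contactEquiv_corresponds (x : Q5) : Corresponds x (contactEquiv x) := x.corresponds_toPC


/-! ### Calculus of curves in `ℝ³` -/

theorem _root_.HasDerivAt.dot {u v : ℝ → R3} {u' v' : R3} {t : ℝ} (hu : HasDerivAt u u' t)
    (hv : HasDerivAt v v' t) :
    HasDerivAt (fun s => u s ⬝ᵥ v s) (u' ⬝ᵥ v t + u t ⬝ᵥ v') t := by
  rw [hasDerivAt_pi] at hu hv
  simp only [dot_expand]
  refine ((((hu 0).mul (hv 0)).add ((hu 1).mul (hv 1))).add ((hu 2).mul (hv 2))).congr_deriv ?_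
  ring

theorem _root_.HasDerivAt.cross {u v : ℝ → R3} {u' v' : R3} {t : ℝ} (hu : HasDerivAt u u' t)
    (hv : HasDerivAt v v' t) :
    HasDerivAt (fun s => u s ⨯₃ v s) (u' ⨯₃ v t + u t ⨯₃ v') t := by
  rw [hasDerivAt_pi] at hu hv ⊢
  intro i
  fin_cases i <;>
    simp only [Fin.zero_eta, Fin.mk_one, Fin.reduceFinMk, Pi.add_apply, cross_apply_zero,
      cross_apply_one, cross_apply_two]
  · refine (((hu 1).mul (hv 2)).sub ((hu 2).mul (hv 1))).congr_deriv ?_; ring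
  · refine (((hu 2).mul (hv 0)).sub ((hu 0).mul (hv 2))).congr_deriv ?_; ring
  · refine (((hu 0).mul (hv 1)).sub ((hu 1).mul (hv 0))).congr_deriv ?_; ring

theorem _root_.ContDiffAt.dot {n : WithTop ℕ∞} {u v : ℝ → R3} {t : ℝ} (hu : ContDiffAt ℝ n u t)
    (hv : ContDiffAt ℝ n v t) : ContDiffAt ℝ n (fun s => u s ⬝ᵥ v s) t := by
  rw [contDiffAt_pi] at hu hv
  simp only [dot_expand]
  exact (((hu 0).mul (hv 0)).add ((hu 1).mul (hv 1))).add ((hu 2).mul (hv 2))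

theorem _root_.ContDiffAt.cross {n : WithTop ℕ∞} {u v : ℝ → R3} {t : ℝ} (hu : ContDiffAt ℝ n u t)
    (hv : ContDiffAt ℝ n v t) : ContDiffAt ℝ n (fun s => u s ⨯₃ v s) t := by
  rw [contDiffAt_pi] at hu hv ⊢
  intro i
  fin_cases i <;>
    simp only [Fin.zero_eta, Fin.mk_one, Fin.reduceFinMk, cross_apply_zero,
      cross_apply_one, cross_apply_two]
  · exact ((hu 1).mul (hv 2)).sub ((hu 2).mul (hv 1))
  · exact ((hu 2).mul (hv 0)).sub ((hu 0).mul (hv 2))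
  · exact ((hu 0).mul (hv 1)).sub ((hu 1).mul (hv 0))

theorem _root_.ContDiffAt.deriv_infty {E : Type*} [NormedAddCommGroup E] [NormedSpace ℝ E]
    {f : ℝ → E} {t : ℝ} (h : ContDiffAt ℝ ∞ f t) : ContDiffAt ℝ ∞ (deriv f) t :=
  h.derivWithin (by simp)

theorem _root_.ContDiffAt.hasDerivAt_infty {E : Type*} [NormedAddCommGroup E] [NormedSpace ℝ E]
    {f : ℝ → E} {t : ℝ} (h : ContDiffAt ℝ ∞ f t) : HasDerivAt f (deriv f t) t :=
  (h.differentiableAt (by simp)).hasDerivAt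

/-- A function with smooth nonvanishing cube is smooth. -/
theorem contDiffAt_of_cube {α : ℝ → ℝ} {t : ℝ} {n : WithTop ℕ∞}
    (h : ContDiffAt ℝ n (fun s => α s ^ 3) t) (h0 : α t ≠ 0) : ContDiffAt ℝ n α t := by
  have key : ∀ β : ℝ → ℝ, ContDiffAt ℝ n (fun s => β s ^ 3) t → 0 < β t → ContDiffAt ℝ n β t := by
    intro β hβ hpos
    have h1 := hβ.rpow_const_of_ne (p := ((3 : ℕ) : ℝ)⁻¹) (pow_pos hpos 3).ne'
    refine h1.congr_of_eventuallyEq ?_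
    have h2 := hβ.continuousAt.eventually_const_lt (u := 0) (pow_pos hpos 3)
    filter_upwards [h2] with s hs
    have : 0 < β s := by
      by_contra! hle
      exact absurd hs (not_lt.2 (Odd.pow_nonpos (by decide) hle))
    exact (Real.pow_rpow_inv_natCast this.le three_ne_zero).symm
  rcases lt_or_gt_of_ne h0 with hneg | hpos
  · have := key (fun s => -α s) (by simpa [Odd.neg_pow (show Odd 3 by decide)] using h.neg)
      (by simpa using hneg)
    simpa using this.neg
  · exact key α h hpos

/-! ### Lifts of curves -/

theorem IsLiftNear.exists_factor {c : ℝ → Plane} {A B : ℝ → R3} {t : ℝ} (hA : IsLiftNear c A t)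
    (hB : IsLiftNear c B t) :
    ∃ μ : ℝ → ℝ, ∀ᶠ s in 𝓝 t, μ s ≠ 0 ∧ B s = μ s • A s := by
  have : ∀ s, ∃ k : ℝ, (A s ≠ 0 ∧ A s ∈ (c s).submodule) → (B s ≠ 0 ∧ B s ∈ (c s).submodule) →
      k ≠ 0 ∧ B s = k • A s := by
    intro s
    by_cases h : A s ≠ 0 ∧ A s ∈ (c s).submodule
    · by_cases h' : B s ≠ 0 ∧ B s ∈ (c s).submodule
      · obtain ⟨k, hk⟩ := (mem_iff_smul h.1 h.2).1 h'.2
        refine ⟨k, fun _ _ => ⟨?_, hk.symm⟩⟩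
        rintro rfl
        exact h'.1 (by rw [← hk, zero_smul])
      · exact ⟨0, fun _ h2 => absurd h2 h'⟩
    · exact ⟨0, fun h1 => absurd h1 h⟩
  choose μ hμ using this
  exact ⟨μ, by filter_upwards [hA, hB] with s h1 h2 using hμ s h1 h2⟩

/-- Pairing with the fixed vector `A t` expresses the factor between two lifts as a quotient, so
that it inherits their regularity. -/
theorem dot_div_eventually {A B : ℝ → R3} {μ : ℝ → ℝ} {t : ℝ} (hc : ContinuousAt A t)
    (h0 : A t ≠ 0) (hμ : ∀ᶠ s in 𝓝 t, μ s ≠ 0 ∧ B s = μ s • A s) :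
    ∀ᶠ s in 𝓝 t, (A t ⬝ᵥ B s) / (A t ⬝ᵥ A s) = μ s := by
  have h1 : ContinuousAt (fun s => A t ⬝ᵥ A s) t := by
    rw [continuousAt_pi] at hc
    simp only [dot_expand]
    fun_prop
  filter_upwards [hμ, h1.eventually_ne (dot_self_pos h0)] with s hs hs'
  rw [hs.2, dotProduct_smul, smul_eq_mul, mul_div_cancel_right₀ _ hs']

theorem _root_.ContDiffAt.factor {A B : ℝ → R3} {μ : ℝ → ℝ} {t : ℝ} (hA : ContDiffAt ℝ ∞ A t)
    (hB : ContDiffAt ℝ ∞ B t) (h0 : A t ≠ 0) (hμ : ∀ᶠ s in 𝓝 t, μ s ≠ 0 ∧ B s = μ s • A s) :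
    ContDiffAt ℝ ∞ μ t := by
  have h := ((contDiffAt_const (c := A t)).dot hB).div ((contDiffAt_const (c := A t)).dot hA)
    (dot_self_pos h0)
  refine h.congr_of_eventuallyEq ?_
  filter_upwards [dot_div_eventually hA.continuousAt h0 hμ] with s hs using hs.symm

theorem _root_.HasDerivAt.factor {A B : ℝ → R3} {A' B' : R3} {μ : ℝ → ℝ} {t : ℝ}
    (hA : HasDerivAt A A' t) (hB : HasDerivAt B B' t) (h0 : A t ≠ 0) (hμ : ∀ᶠ s in 𝓝 t, μ s ≠ 0 ∧ B s = μ s • A s) :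
    ∃ μ', HasDerivAt μ μ' t := by
  have h := ((hasDerivAt_const t (A t)).dot hB).div ((hasDerivAt_const t (A t)).dot hA)
    (dot_self_pos h0)
  refine ⟨_, h.congr_of_eventuallyEq ?_⟩
  filter_upwards [dot_div_eventually hA.continuousAt h0 hμ] with s hs using hs.symm

theorem IsLiftNear.ne_zero {c : ℝ → Plane} {A : ℝ → R3} {t : ℝ} (h : IsLiftNear c A t) : A t ≠ 0 :=
  h.self_of_nhds.1

theorem IsLiftNear.mem {c : ℝ → Plane} {A : ℝ → R3} {t : ℝ} (h : IsLiftNear c A t) :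
    A t ∈ (c t).submodule :=
  h.self_of_nhds.2

/-- The velocity can be computed from any differentiable lift: for `B = μA` the extra term `μ'A` of
`B'` is killed by `dπ`. -/
theorem HasVelocityAt.isDPi {c : ℝ → Plane} {B : ℝ → R3} {B' : R3} {t : ℝ} {v : Tang (c t)}
    (hv : HasVelocityAt c t v) (hB : IsLiftNear c B t) (hB' : HasDerivAt B B' t) :
    IsDPi (B t) B' v := by
  obtain ⟨A, A', hA, hA', h⟩ := hv
  obtain ⟨μ, hμ⟩ := hA.exists_factor hB
  obtain ⟨μ', hμ'⟩ := hA'.factor hB' hA.ne_zero hμ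
  have h1 := hμ'.smul hA'
  have h2 : B' = μ t • A' + μ' • A t :=
    hB'.unique (h1.congr_of_eventuallyEq (by filter_upwards [hμ] with s hs using hs.2))
  have h3 := h.smul hμ.self_of_nhds.1
  rw [hμ.self_of_nhds.2, h2]
  refine h3.congr_iff.2 ⟨μ' / μ t, ?_⟩
  rw [smul_smul, div_mul_cancel₀ _ hμ.self_of_nhds.1]

theorem hasVelocityAt_iff {c : ℝ → Plane} {B : ℝ → R3} {B' : R3} {t : ℝ} {v : Tang (c t)}
    (hB : IsLiftNear c B t) (hB' : HasDerivAt B B' t) :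
    HasVelocityAt c t v ↔ IsDPi (B t) B' v :=
  ⟨fun h => h.isDPi hB hB', fun h => ⟨B, B', hB, hB', h⟩⟩

/-! ### Smooth curves in `Q⁵` and smooth curves of projective contact elements -/

theorem Q5.contDiffAt_iff {Γ : ℝ → Q5} {t : ℝ} :
    ContDiffAt ℝ ∞ (fun s => (Γ s).1) t ↔
      ContDiffAt ℝ ∞ (fun s => (Γ s).vec) t ∧ ContDiffAt ℝ ∞ (fun s => (Γ s).cov) t :=
  ⟨fun h => ⟨h.fst, h.snd⟩, fun h => h.1.prodMk h.2⟩

theorem Corresponds.isLiftNear_vec {Γ : ℝ → Q5} {c : ℝ → PC} (h : ∀ s, Corresponds (Γ s) (c s))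
    (t : ℝ) : IsLiftNear (fun s => (c s).q) (fun s => (Γ s).vec) t :=
  Eventually.of_forall fun s => ⟨(Γ s).vec_ne_zero, (h s).vec_mem⟩

theorem Corresponds.isLiftNear_cov {Γ : ℝ → Q5} {c : ℝ → PC} (h : ∀ s, Corresponds (Γ s) (c s))
    (t : ℝ) : IsLiftNear (fun s => (c s).p) (fun s => (Γ s).cov) t :=
  Eventually.of_forall fun s => ⟨(Γ s).cov_ne_zero, (h s).cov_mem⟩

theorem SmoothCurveOn.toPC {Γ : ℝ → Q5} {c : ℝ → PC} (h : ∀ s, Corresponds (Γ s) (c s))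
    {I : Set ℝ} (hΓ : Q5.SmoothCurveOn Γ I) : PC.SmoothCurveOn c I := by
  refine ⟨fun t ht => ⟨_, Corresponds.isLiftNear_vec h t, (Q5.contDiffAt_iff.1 (hΓ t ht)).1⟩,
    fun t ht => ⟨_, Corresponds.isLiftNear_cov h t, (Q5.contDiffAt_iff.1 (hΓ t ht)).2⟩, ?_⟩
  rintro t ht w ⟨A, X, hA, hX, hw⟩
  obtain ⟨hq, hp⟩ := Q5.contDiffAt_iff.1 (hΓ t ht)
  obtain ⟨μ, hμ⟩ := hA.1.exists_factor (Corresponds.isLiftNear_vec h t)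
  have hμs := hA.2.factor hq hA.1.ne_zero hμ
  refine ⟨fun s => (Γ s).cov, fun s => (Γ s).vec ⨯₃ (μ s • X s),
    ⟨Corresponds.isLiftNear_cov h t, hp⟩, hq.cross (hμs.smul hX), ?_⟩
  filter_upwards [hμ, hw] with s h1 h2
  have h3 := h2.smul h1.1
  rw [← h1.2] at h3
  exact (h s).2.2 _ _ h3

theorem cross_cross_dot' (A X B : R3) : (A ⨯₃ X) ⨯₃ B = (A ⬝ᵥ B) • X - (X ⬝ᵥ B) • A := by
  rw [← cross_anticomm, ← cross_anticomm X A, map_neg, neg_neg, cross_cross_dot,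
    dotProduct_comm B X]

/-- Over smooth lifts `A`, `B` the curve is `(αA, βB)`. Applying `ψ` to the field represented by a
constant `X` exhibits `α³` as a quotient of smooth functions; then `α` is smooth, and so is `β`
because `βα (A · B) = 1`. -/
theorem SmoothCurveOn.ofPC {Γ : ℝ → Q5} {c : ℝ → PC} (h : ∀ s, Corresponds (Γ s) (c s))
    {I : Set ℝ} (hc : PC.SmoothCurveOn c I) : Q5.SmoothCurveOn Γ I := by
  intro t ht
  obtain ⟨A, hA⟩ := hc.1 t ht
  obtain ⟨B, hB⟩ := hc.2.1 t ht
  obtain ⟨α, hα⟩ := hA.1.exists_factor (Corresponds.isLiftNear_vec h t)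
  obtain ⟨β, hβ⟩ := hB.1.exists_factor (Corresponds.isLiftNear_cov h t)
  have hαβ : ∀ᶠ s in 𝓝 t, β s * α s * (A s ⬝ᵥ B s) = 1 := by
    filter_upwards [hα, hβ] with s h1 h2
    have := (Γ s).cov_dot_vec
    rw [h1.2, h2.2, smul_dotProduct, dotProduct_smul, smul_eq_mul, smul_eq_mul,
      dotProduct_comm] at this
    rw [← this, mul_assoc]
  have hAB : A t ⬝ᵥ B t ≠ 0 := right_ne_zero_of_mul_eq_one hαβ.self_of_nhds
  obtain ⟨X, hX⟩ := exists_cross_ne_zero hA.1.ne_zero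
  -- the field along `q` that is represented by the constant vector `X` over the lift `A`
  have hex : ∀ s, ∃ w : Tang (c s).q, A s ≠ 0 → A s ∈ (c s).q.submodule → IsDPi (A s) X w := by
    intro s
    by_cases h0 : A s ≠ 0
    · by_cases h1 : A s ∈ (c s).q.submodule
      · obtain ⟨w, hw⟩ := exists_isDPi h0 h1 X
        exact ⟨w, fun _ _ => hw⟩
      · exact ⟨0, fun _ h2 => absurd h2 h1⟩
    · exact ⟨0, fun h2 => absurd h2 h0⟩
  choose w hw using hex
  obtain ⟨C, Y, hC, hY, hCY⟩ := hc.2.2 t ht w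
    ⟨A, fun _ => X, hA, contDiffAt_const, by filter_upwards [hA.1] with s hs using hw s hs.1 hs.2⟩
  obtain ⟨γ, hγ⟩ := hC.1.exists_factor hB.1
  have hγs := hC.2.factor hB.2 hC.1.ne_zero hγ
  -- Representatives of `ψ w` over `B` are unique modulo `B`; the product with `B` removes this
  -- ambiguity. The factor is `β⁻¹α²`, rewritten with `β⁻¹ = α (A · B)`.
  have hZ : ∀ᶠ s in 𝓝 t, (γ s • Y s) ⨯₃ B s =
      (α s ^ 3 * (A s ⬝ᵥ B s)) • (A s ⨯₃ X) ⨯₃ B s := by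
    filter_upwards [hα, hβ, hγ, hCY, hA.1, hαβ] with s h1 h2 h3 h4 h5 h6
    have e1 := h4.smul h3.1
    rw [← h3.2] at e1
    have e2 := (hw s h5.1 h5.2).smul h1.1
    rw [← h1.2] at e2
    have e3 := ((h s).2.2 _ _ e2).smul (inv_ne_zero h2.1)
    rw [h2.2, smul_smul, inv_mul_cancel₀ h2.1, one_smul] at e3
    obtain ⟨k, hk⟩ := e3.congr_iff.1 e1
    have e4 : (β s)⁻¹ * (α s * α s) = α s ^ 3 * (A s ⬝ᵥ B s) := by
      rw [inv_mul_eq_iff_eq_mul₀ h2.1]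
      linear_combination (-(α s ^ 2)) * h6
    rw [hk, h1.2]
    simp only [map_add, LinearMap.add_apply, map_smul, LinearMap.smul_apply, cross_self, smul_zero,
      add_zero, smul_smul]
    rw [e4]
  -- The vector is nonzero because its product with `A` is `(A · B) A × X`. A nonzero component
  -- serves as denominator.
  obtain ⟨i, hi⟩ : ∃ i, ((A t ⨯₃ X) ⨯₃ B t) i ≠ 0 := by
    by_contra! hz
    have h1 : (A t ⨯₃ X) ⨯₃ B t = 0 := funext hz
    rw [cross_cross_dot'] at h1
    have h2 := congrArg (fun y => A t ⨯₃ y) h1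
    simp only [map_sub, map_smul, cross_self, smul_zero, sub_zero, map_zero, smul_eq_zero] at h2
    exact h2.elim hAB hX
  have hAXB := (hA.2.cross (contDiffAt_const (c := X))).cross hB.2
  have hZs := (hγs.smul hY).cross hB.2
  have hcont := (contDiffAt_pi.1 hAXB i).continuousAt.eventually_ne hi
  have hABs := hA.2.dot hB.2
  have hcube : ContDiffAt ℝ ∞ (fun s => α s ^ 3) t := by
    have h1 := ((contDiffAt_pi.1 hZs i).div (contDiffAt_pi.1 hAXB i) hi).div hABs hAB
    refine h1.congr_of_eventuallyEq ?_
    filter_upwards [hZ, hcont, hABs.continuousAt.eventually_ne hAB] with s h1 h2 h3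
    have h4 := congrFun h1 i
    rw [Pi.smul_apply, smul_eq_mul] at h4
    change α s ^ 3 = ((γ s • Y s) ⨯₃ B s) i / ((A s ⨯₃ X) ⨯₃ B s) i / (A s ⬝ᵥ B s)
    rw [eq_div_iff h3, eq_div_iff h2]
    exact h4.symm
  have hαs := contDiffAt_of_cube hcube hα.self_of_nhds.1
  have hβs : ContDiffAt ℝ ∞ β t := by
    have h1 := (hαs.mul hABs).inv (mul_ne_zero hα.self_of_nhds.1 hAB)
    refine h1.congr_of_eventuallyEq ?_
    filter_upwards [hαβ] with s hs
    exact eq_inv_of_mul_eq_one_left (by rw [← hs, mul_assoc])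
  rw [Q5.contDiffAt_iff]
  exact ⟨(hαs.smul hA.2).congr_of_eventuallyEq (by filter_upwards [hα] with s hs using hs.2),
    (hβs.smul hB.2).congr_of_eventuallyEq (by filter_upwards [hβ] with s hs using hs.2)⟩


/-! ### Ordinary differential equations with locally bounded right-hand side -/

theorem exists_hasDerivAt_Ioo {v : ℝ → ℝ → ℝ} {a b t₀ : ℝ} (ha : a < t₀) (hb : t₀ < b)
    (hv : ∀ x, ContinuousOn (fun t => v t x) (Set.Icc a b)) {K : NNReal}
    (hK : ∀ t ∈ Set.Icc a b, LipschitzWith K (v t) ∧ ∀ x, |v t x| ≤ K) (x₀ : ℝ) :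
    ∃ f : ℝ → ℝ, f t₀ = x₀ ∧ ∀ t ∈ Set.Ioo a b, HasDerivAt f (v t (f t)) t := by
  -- The radius is the distance covered at speed `K` within the interval. The bounds on `v` hold for
  -- all `x`, so no shrinking of the time interval is needed.
  have hpl : IsPicardLindelof v (⟨t₀, ha.le, hb.le⟩ : Set.Icc a b) x₀
      (K * Real.toNNReal (max (b - t₀) (t₀ - a))) 0 K K :=
    { lipschitzOnWith := fun t ht => (hK t ht).1.lipschitzOnWith
      continuousOn := fun x _ => hv x
      norm_le := fun t ht x _ => (hK t ht).2 x
      mul_max_le := by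
        have : 0 ≤ max (b - t₀) (t₀ - a) := le_max_of_le_left (by linarith)
        simp [Real.coe_toNNReal _ this] }
  obtain ⟨f, hf0, hf⟩ := hpl.exists_eq_forall_mem_Icc_hasDerivWithinAt₀
  exact ⟨f, hf0, fun t ht => (hf t (Set.Ioo_subset_Icc_self ht)).hasDerivAt
    (Icc_mem_nhds ht.1 ht.2)⟩

theorem exists_Icc_subset {I : Set ℝ} (hI : IsOpen I) (hc : I.OrdConnected) {s t : ℝ} (hs : s ∈ I)
    (ht : t ∈ I) : ∃ a b, a < s ∧ a < t ∧ s < b ∧ t < b ∧ Set.Icc a b ⊆ I := by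
  have hmin : min s t ∈ I := by rcases min_choice s t with h | h <;> rwa [h]
  have hmax : max s t ∈ I := by rcases max_choice s t with h | h <;> rwa [h]
  obtain ⟨a, ha, haI⟩ : ∃ a, a < min s t ∧ a ∈ I := by
    obtain ⟨ε, hε, h⟩ := Metric.isOpen_iff.1 hI _ hmin
    exact ⟨min s t - ε / 2, by linarith, h (by
      rw [Metric.mem_ball, Real.dist_eq, abs_lt]; constructor <;> linarith)⟩
  obtain ⟨b, hb, hbI⟩ : ∃ b, max s t < b ∧ b ∈ I := by
    obtain ⟨ε, hε, h⟩ := Metric.isOpen_iff.1 hI _ hmax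
    exact ⟨max s t + ε / 2, by linarith, h (by
      rw [Metric.mem_ball, Real.dist_eq, abs_lt]; constructor <;> linarith)⟩
  exact ⟨a, b, (lt_min_iff.1 ha).1, (lt_min_iff.1 ha).2, (max_lt_iff.1 hb).1, (max_lt_iff.1 hb).2,
    hc.out haI hbI⟩

/-- Global solutions on an open interval of an equation `f' = v(t, f)` with `v` bounded and
Lipschitz in `f`, uniformly for `t` in compact intervals. -/
theorem exists_global_solution {I : Set ℝ} (hI : IsOpen I) (hc : I.OrdConnected) {v : ℝ → ℝ → ℝ}
    (hv : ∀ x, ContinuousOn (fun t => v t x) I)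
    (hK : ∀ a b, Set.Icc a b ⊆ I → ∃ K : NNReal, ∀ t ∈ Set.Icc a b,
      LipschitzWith K (v t) ∧ ∀ x, |v t x| ≤ K) {t₀ : ℝ} (ht₀ : t₀ ∈ I) (x₀ : ℝ) :
    ∃ f : ℝ → ℝ, f t₀ = x₀ ∧ ∀ t ∈ I, HasDerivAt f (v t (f t)) t := by
  have hex : ∀ t, ∃ a b : ℝ, ∃ f : ℝ → ℝ, t ∈ I → (a < t₀ ∧ a < t ∧ t₀ < b ∧ t < b ∧
      Set.Icc a b ⊆ I ∧ f t₀ = x₀ ∧ ∀ s ∈ Set.Ioo a b, HasDerivAt f (v s (f s)) s) := by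
    intro t
    by_cases ht : t ∈ I
    · obtain ⟨a, b, h1, h2, h3, h4, h5⟩ := exists_Icc_subset hI hc ht₀ ht
      obtain ⟨K, hK⟩ := hK a b h5
      obtain ⟨f, hf⟩ := exists_hasDerivAt_Ioo h1 h3 (fun x => (hv x).mono h5) hK x₀
      exact ⟨a, b, f, fun _ => ⟨h1, h2, h3, h4, h5, hf⟩⟩
    · exact ⟨0, 0, 0, fun h => absurd h ht⟩
  choose a b f hf using hex
  -- Each `f t` solves the equation on an interval containing both `t₀` and `t`. Uniqueness makes
  -- the diagonal `t ↦ f t t` agree locally with a single solution.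
  have hagree : ∀ t ∈ I, ∀ s ∈ I, s ∈ Set.Ioo (a t) (b t) → f s s = f t s := by
    intro t ht s hs hst
    obtain ⟨h1, h2, h3, h4, h5, h6, h7⟩ := hf t ht
    obtain ⟨k1, k2, k3, k4, k5, k6, k7⟩ := hf s hs
    obtain ⟨K, hK⟩ := hK _ _ h5
    have hsub : Set.Ioo (max (a t) (a s)) (min (b t) (b s)) ⊆ Set.Ioo (a t) (b t) :=
      Set.Ioo_subset_Ioo (le_max_left _ _) (min_le_left _ _)
    have hsub' : Set.Ioo (max (a t) (a s)) (min (b t) (b s)) ⊆ Set.Ioo (a s) (b s) :=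
      Set.Ioo_subset_Ioo (le_max_right _ _) (min_le_right _ _)
    exact ODE_solution_unique_of_mem_Ioo (v := v) (s := fun _ => Set.univ) (K := K)
      (fun r hr => (hK r (Set.Ioo_subset_Icc_self (hsub hr))).1.lipschitzOnWith)
      ⟨max_lt h1 k1, lt_min h3 k3⟩
      (fun r hr => ⟨k7 r (hsub' hr), trivial⟩) (fun r hr => ⟨h7 r (hsub hr), trivial⟩)
      (k6.trans h6.symm) ⟨max_lt hst.1 k2, lt_min hst.2 k4⟩
  refine ⟨fun t => f t t, (hf t₀ ht₀).2.2.2.2.2.1, fun t ht => ?_⟩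
  obtain ⟨h1, h2, h3, h4, h5, h6, h7⟩ := hf t ht
  refine (h7 t ⟨h2, h4⟩).congr_of_eventuallyEq ?_
  filter_upwards [Ioo_mem_nhds h2 h4] with s hs
  exact hagree t ht s (h5 (Set.Ioo_subset_Icc_self hs)) hs

/-- Solutions `(m : n)` in the projective line of a Riccati equation exist globally. -/
theorem exists_riccati_solution {I : Set ℝ} (hI : IsOpen I) (hc : I.OrdConnected) {α e : ℝ → ℝ}
    (hα : ContinuousOn α I) (he : ContinuousOn e I) {t₀ : ℝ} (ht₀ : t₀ ∈ I) (s₀ : ℝ) :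
    ∃ m n m' n' : ℝ → ℝ, m t₀ = s₀ * n t₀ ∧ n t₀ ≠ 0 ∧
      ∀ t ∈ I, HasDerivAt m (m' t) t ∧ HasDerivAt n (n' t) t ∧ (m t ≠ 0 ∨ n t ≠ 0) ∧
        m' t * n t - m t * n' t = m t ^ 2 / 2 + α t * m t * n t + e t * n t ^ 2 := by
  -- The equation for the angle `θ` in `(m, n) = (cos θ, sin θ)`, where `m'n - mn' = -θ'`. It is
  -- bounded and Lipschitz in `θ` on compact time intervals, so a blow-up of `m / n` is only a
  -- passage through `n = 0`.
  set v : ℝ → ℝ → ℝ := fun t x =>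
    -(Real.cos x ^ 2 / 2 + α t * Real.cos x * Real.sin x + e t * Real.sin x ^ 2) with hv
  have hcont : ∀ x, ContinuousOn (fun t => v t x) I := fun x => by
    simp only [hv]; fun_prop
  have hK : ∀ a b, Set.Icc a b ⊆ I → ∃ K : NNReal, ∀ t ∈ Set.Icc a b,
      LipschitzWith K (v t) ∧ ∀ x, |v t x| ≤ K := by
    intro a b hab
    obtain ⟨C, hC⟩ := isCompact_Icc.exists_bound_of_continuousOn (hα.mono hab)
    obtain ⟨D, hD⟩ := isCompact_Icc.exists_bound_of_continuousOn (he.mono hab)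
    -- One estimate for both `v` and its derivative in the angle.
    have hbound : ∀ t ∈ Set.Icc a b, ∀ x y z : ℝ, |x| ≤ 1 → |y| ≤ 1 → |z| ≤ 1 →
        |x + α t * y + 2 * e t * z| ≤ (Real.toNNReal (1 + C + 2 * D) : ℝ) := by
      intro t ht x y z hx hy hz
      refine le_trans ?_ (Real.le_coe_toNNReal _)
      have h1 := hC t ht
      have h2 := hD t ht
      rw [Real.norm_eq_abs] at h1 h2
      have h3 : |α t * y| ≤ C * 1 := by
        rw [abs_mul]
        exact mul_le_mul h1 hy (abs_nonneg _) ((abs_nonneg _).trans h1)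
      have h4 : |2 * e t * z| ≤ 2 * D * 1 := by
        rw [abs_mul, abs_mul, abs_two]
        exact mul_le_mul (by linarith) hz (abs_nonneg _) (by linarith [(abs_nonneg _).trans h2])
      have := abs_add_three x (α t * y) (2 * e t * z)
      linarith
    refine ⟨Real.toNNReal (1 + C + 2 * D), fun t ht => ⟨?_, fun x => ?_⟩⟩
    · have hd : ∀ x, HasDerivAt (v t) ((Real.sin x * Real.cos x) +
          α t * (Real.sin x ^ 2 - Real.cos x ^ 2) + 2 * e t * (-(Real.sin x * Real.cos x))) x := by
        intro x
        have h1 := ((((Real.hasDerivAt_cos x).pow 2).div_const 2).add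
          (((Real.hasDerivAt_cos x).const_mul (α t)).mul (Real.hasDerivAt_sin x))).add
          (((Real.hasDerivAt_sin x).pow 2).const_mul (e t))
        refine h1.neg.congr_deriv ?_
        push_cast
        ring
      refine lipschitzWith_of_nnnorm_deriv_le (fun x => (hd x).differentiableAt) fun x => ?_
      rw [(hd x).deriv, ← NNReal.coe_le_coe, coe_nnnorm, Real.norm_eq_abs]
      have hsc : |Real.sin x * Real.cos x| ≤ 1 := by
        rw [abs_mul]
        exact mul_le_one₀ (Real.abs_sin_le_one x) (abs_nonneg _) (Real.abs_cos_le_one x)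
      refine hbound t ht _ _ _ hsc ?_ (by rwa [abs_neg])
      have := Real.sin_sq_add_cos_sq x
      rw [abs_le]
      constructor <;> nlinarith [sq_nonneg (Real.sin x), sq_nonneg (Real.cos x)]
    · have hsc : |-(Real.cos x * Real.sin x)| ≤ 1 := by
        rw [abs_neg, abs_mul]
        exact mul_le_one₀ (Real.abs_cos_le_one x) (abs_nonneg _) (Real.abs_sin_le_one x)
      have := Real.sin_sq_add_cos_sq x
      have h := hbound t ht (-(Real.cos x ^ 2 / 2)) (-(Real.cos x * Real.sin x))
        (-(Real.sin x ^ 2 / 2))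
        (by rw [abs_le]; constructor <;> nlinarith [sq_nonneg (Real.sin x), sq_nonneg (Real.cos x)])
        hsc
        (by rw [abs_le]; constructor <;> nlinarith [sq_nonneg (Real.sin x), sq_nonneg (Real.cos x)])
      convert h using 2
      ring
  obtain ⟨θ₀, hθ₀, hsin⟩ : ∃ θ₀ : ℝ, Real.cos θ₀ = s₀ * Real.sin θ₀ ∧ Real.sin θ₀ ≠ 0 := by
    refine ⟨Real.pi / 2 - Real.arctan s₀, ?_, ?_⟩
    · rw [Real.cos_pi_div_two_sub, Real.sin_pi_div_two_sub,
        ← Real.tan_mul_cos (Real.cos_arctan_pos _).ne',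
        Real.tan_arctan]
    · rw [Real.sin_pi_div_two_sub]
      exact (Real.cos_arctan_pos _).ne'
  obtain ⟨θ, hθ, hθ'⟩ := exists_global_solution hI hc hcont hK ht₀ θ₀
  refine ⟨fun t => Real.cos (θ t), fun t => Real.sin (θ t), fun t => -Real.sin (θ t) * v t (θ t),
    fun t => Real.cos (θ t) * v t (θ t), by simp only [hθ, hθ₀],
    by simpa only [hθ] using hsin, fun t ht =>
    ⟨(hθ' t ht).cos, (hθ' t ht).sin, ?_, ?_⟩⟩
  · by_contra! h
    have := Real.sin_sq_add_cos_sq (θ t)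
    rw [h.1, h.2] at this
    norm_num at this
  · have := Real.sin_sq_add_cos_sq (θ t)
    simp only [hv]
    linear_combination (Real.cos (θ t) ^ 2 / 2 + α t * Real.cos (θ t) * Real.sin (θ t) +
      e t * Real.sin (θ t) ^ 2) * this

/-! ### Order of vanishing -/

/-- Mean value inequality on the segment from `t` to `s`, where `|f'| ≤ C |s - t| ^ n`. -/
theorem isBigO_pow_succ_of_deriv {f f' : ℝ → ℝ} {t : ℝ} {n : ℕ}
    (hf : ∀ᶠ s in 𝓝 t, HasDerivAt f (f' s) s) (h0 : f t = 0)
    (h : f' =O[𝓝 t] fun s => (s - t) ^ n) : f =O[𝓝 t] fun s => (s - t) ^ (n + 1) := by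
  obtain ⟨C, hC⟩ := h.bound
  obtain ⟨ε, hε, hball⟩ := Metric.eventually_nhds_iff_ball.1 (hf.and hC)
  refine IsBigO.of_bound C ?_
  filter_upwards [Metric.ball_mem_nhds t hε] with s hs
  have hseg : ∀ r ∈ Set.uIcc t s, |r - t| ≤ |s - t| := fun r hr => Set.abs_sub_left_of_mem_uIcc hr
  have hsub : ∀ r ∈ Set.uIcc t s, r ∈ Metric.ball t ε := fun r hr => by
    rw [Metric.mem_ball, Real.dist_eq] at hs ⊢
    exact (hseg r hr).trans_lt hs
  -- The constant of a big-O bound may be negative a priori; the bound at a point `s ≠ t` excludes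
  -- this.
  have hCnn : 0 ≤ C ∨ s = t := by
    by_cases hst : s = t
    · exact Or.inr hst
    · left
      have := (norm_nonneg _).trans (hball s hs).2
      have h2 : 0 < ‖(s - t) ^ n‖ := norm_pos_iff.2 (pow_ne_zero _ (sub_ne_zero.2 hst))
      exact nonneg_of_mul_nonneg_left this h2
  rcases hCnn with hCnn | rfl
  · have := (convex_uIcc t s).norm_image_sub_le_of_norm_hasDerivWithin_le
      (C := C * |s - t| ^ n) (f := f) (f' := f')
      (fun r hr => (hball r (hsub r hr)).1.hasDerivWithinAt)
      (fun r hr => by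
        refine (hball r (hsub r hr)).2.trans ?_
        rw [norm_pow, Real.norm_eq_abs]
        exact mul_le_mul_of_nonneg_left (pow_le_pow_left₀ (abs_nonneg _) (hseg r hr) n) hCnn)
      Set.left_mem_uIcc Set.right_mem_uIcc
    rw [h0, sub_zero] at this
    rwa [pow_succ, norm_mul, norm_pow, ← mul_assoc, Real.norm_eq_abs (s - t)]
  · simp [h0]

/-- Taylor's formula for a chain of derivatives `f 0, f 1, …, f n`. -/
theorem taylor_isBigO {t : ℝ} (n : ℕ) : ∀ f : ℕ → ℝ → ℝ,
    (∀ k < n, ∀ᶠ s in 𝓝 t, HasDerivAt (f k) (f (k + 1) s) s) → DifferentiableAt ℝ (f n) t →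
    (fun s => f 0 s - ∑ k ∈ Finset.range (n + 1), f k t / k.factorial * (s - t) ^ k)
      =O[𝓝 t] fun s => (s - t) ^ (n + 1) := by
  induction n with
  | zero =>
    intro f _ hd
    simpa using hd.isBigO_sub
  | succ n ih =>
    intro f hf hd
    have h1 := ih (fun k => f (k + 1)) (fun k hk => hf (k + 1) (by omega)) hd
    refine isBigO_pow_succ_of_deriv ?_ ?_ h1
    · filter_upwards [hf 0 (by omega)] with s hs
      refine hs.sub ?_
      rw [show (fun s : ℝ => ∑ k ∈ Finset.range (n + 1 + 1), f k t / k.factorial * (s - t) ^ k) =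
        fun s => (∑ k ∈ Finset.range (n + 1), f (k + 1) t / (k + 1).factorial * (s - t) ^ (k + 1)) +
          f 0 t from funext fun s => by rw [Finset.sum_range_succ']; simp]
      refine HasDerivAt.add_const _ (HasDerivAt.fun_sum fun k _ => ?_)
      have h2 := (((hasDerivAt_id s).sub_const t).pow (k + 1)).const_mul
        (f (k + 1) t / (k + 1).factorial)
      refine h2.congr_deriv ?_
      rw [Nat.factorial_succ]
      have : ((k + 1 : ℕ) : ℝ) ≠ 0 := by positivity
      have : ((k.factorial : ℕ) : ℝ) ≠ 0 := by positivity
      push_cast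
      simp
      field_simp
    · simp [Finset.sum_range_succ']

/-- The limit `s → t` kills the constant term, after which both sides are divided by `s - t`; hence
the punctured neighbourhood. -/
theorem coeff_eq_zero_of_isBigO {t : ℝ} (n : ℕ) : ∀ c : ℕ → ℝ,
    ((fun s => ∑ k ∈ Finset.range n, c k * (s - t) ^ k) =O[𝓝[≠] t] fun s => (s - t) ^ n) →
      ∀ k < n, c k = 0 := by
  induction n with
  | zero => intro c _ k hk; omega
  | succ n ih =>
    intro c h
    have h1 : Tendsto (fun s => ∑ k ∈ Finset.range (n + 1), c k * (s - t) ^ k) (𝓝[≠] t)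
        (𝓝 (c 0)) := by
      have hc : Continuous fun s => ∑ k ∈ Finset.range (n + 1), c k * (s - t) ^ k := by fun_prop
      convert (hc.tendsto t).mono_left nhdsWithin_le_nhds using 2
      simp [Finset.sum_range_succ']
    have h2 : Tendsto (fun s => (s - t) ^ (n + 1)) (𝓝[≠] t) (𝓝 0) := by
      have hc : Continuous fun s : ℝ => (s - t) ^ (n + 1) := by fun_prop
      convert (hc.tendsto t).mono_left nhdsWithin_le_nhds using 2
      simp
    have h0 : c 0 = 0 := tendsto_nhds_unique h1 (h.trans_tendsto h2)
    have h3 := ih (fun k => c (k + 1)) (by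
      obtain ⟨C, hC⟩ := h.bound
      refine IsBigO.of_bound C ?_
      filter_upwards [hC, self_mem_nhdsWithin] with s hs hst
      have hpos : 0 < ‖s - t‖ := norm_pos_iff.2 (sub_ne_zero.2 hst)
      have e1 : ∑ k ∈ Finset.range (n + 1), c k * (s - t) ^ k =
          (∑ k ∈ Finset.range n, c (k + 1) * (s - t) ^ k) * (s - t) := by
        rw [Finset.sum_range_succ', h0, zero_mul, add_zero, Finset.sum_mul]
        exact Finset.sum_congr rfl fun k _ => by ring
      rw [e1, pow_succ, norm_mul, norm_mul, ← mul_assoc] at hs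
      exact le_of_mul_le_mul_right hs hpos)
    intro k hk
    rcases k with _ | k
    · exact h0
    · exact h3 k (by omega)

/-- A function with derivatives `f 0, …, f n` vanishes to order `n + 1` iff these are zero. -/
theorem isBigO_pow_iff {t : ℝ} {n : ℕ} {f : ℕ → ℝ → ℝ}
    (hf : ∀ k < n, ∀ᶠ s in 𝓝 t, HasDerivAt (f k) (f (k + 1) s) s)
    (hd : DifferentiableAt ℝ (f n) t) :
    (f 0 =O[𝓝 t] fun s => (s - t) ^ (n + 1)) ↔ ∀ k < n + 1, f k t = 0 := by
  have ht := taylor_isBigO n f hf hd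
  constructor
  · intro h k hk
    have h1 := coeff_eq_zero_of_isBigO (t := t) (n + 1) (fun k => f k t / k.factorial)
      (by simpa using ((h.sub ht).mono nhdsWithin_le_nhds)) k hk
    have : ((k.factorial : ℕ) : ℝ) ≠ 0 := by positivity
    simpa [this] using h1
  · intro h
    refine ht.congr_left fun s => ?_
    rw [Finset.sum_eq_zero, sub_zero]
    intro k hk
    rw [h k (Finset.mem_range.1 hk)]
    simp


/-! ### Moving frames of locally convex curves -/

/-- The coordinate of `w` along `x` in the basis `x, y, z`. -/
noncomputable def tripleCoord (x y z : R3) : R3 →ₗ[ℝ] ℝ where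
  toFun w := (w ⬝ᵥ y ⨯₃ z) / (x ⬝ᵥ y ⨯₃ z)
  map_add' u v := by rw [add_dotProduct, add_div]
  map_smul' k u := by rw [smul_dotProduct, smul_eq_mul, RingHom.id_apply, smul_eq_mul,
    mul_div_assoc]

theorem tripleCoord_apply (x y z w : R3) :
    tripleCoord x y z w = (w ⬝ᵥ y ⨯₃ z) / (x ⬝ᵥ y ⨯₃ z) := rfl

theorem tripleCoord_self {x y z : R3} (h : x ⬝ᵥ y ⨯₃ z ≠ 0) : tripleCoord x y z x = 1 :=
  div_self h

theorem tripleCoord_second (x y z : R3) : tripleCoord x y z y = 0 := by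
  rw [tripleCoord_apply, dot_self_cross, zero_div]

theorem tripleCoord_third (x y z : R3) : tripleCoord x y z z = 0 := by
  rw [tripleCoord_apply, dot_cross_self, zero_div]

theorem tripleCoord_expansion {x y z : R3} (h : x ⬝ᵥ y ⨯₃ z ≠ 0) (w : R3) :
    w = tripleCoord x y z w • x + tripleCoord y z x w • y + tripleCoord z x y w • z := by
  rw [tripleCoord_apply, tripleCoord_apply, tripleCoord_apply, ← triple_product_permutation x y z,
    triple_product_permutation z x y, div_eq_inv_mul, div_eq_inv_mul, div_eq_inv_mul, mul_smul,
    mul_smul, mul_smul, ← smul_add, ← smul_add, cramer_expansion, smul_smul, inv_mul_cancel₀ h,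
    one_smul]

/-- The vector with coordinates `ξ, η, ζ` in the moving frame `A, A', A''`. -/
noncomputable def frameComb (A : ℝ → R3) (t ξ η ζ : ℝ) : R3 :=
  ξ • A t + η • deriv A t + ζ • deriv (deriv A) t

/-- `A` is a lift to `ℝ³ ∖ 0` of the curve `C`, with independent `A, A', A''` and
`A''' = a A + b A' + c A''`. -/
structure MovingFrame (C : ℝ → Plane) (A : ℝ → R3) (a b c : ℝ → ℝ) (I : Set ℝ) : Prop where
  isOpen : IsOpen I
  lift : ∀ t ∈ I, A t ≠ 0 ∧ A t ∈ (C t).submodule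
  smooth : ∀ t ∈ I, ContDiffAt ℝ ∞ A t
  triple_ne : ∀ t ∈ I, A t ⬝ᵥ deriv A t ⨯₃ deriv (deriv A) t ≠ 0
  smooth_a : ∀ t ∈ I, ContDiffAt ℝ ∞ a t
  smooth_b : ∀ t ∈ I, ContDiffAt ℝ ∞ b t
  smooth_c : ∀ t ∈ I, ContDiffAt ℝ ∞ c t
  deriv_three : ∀ t ∈ I, deriv (deriv (deriv A)) t = frameComb A t (a t) (b t) (c t)

namespace MovingFrame

variable {C : ℝ → Plane} {A : ℝ → R3} {a b c : ℝ → ℝ} {I : Set ℝ} {t : ℝ}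

theorem isLiftNear (h : MovingFrame C A a b c I) (ht : t ∈ I) : IsLiftNear C A t := by
  filter_upwards [h.isOpen.mem_nhds ht] with s hs using h.lift s hs

theorem isSmoothLift (h : MovingFrame C A a b c I) (ht : t ∈ I) : IsSmoothLift C A t :=
  ⟨h.isLiftNear ht, h.smooth t ht⟩

theorem coord_comb (h : MovingFrame C A a b c I) (ht : t ∈ I) (ξ η ζ : ℝ) :
    tripleCoord (A t) (deriv A t) (deriv (deriv A) t) (frameComb A t ξ η ζ) = ξ ∧
    tripleCoord (deriv A t) (deriv (deriv A) t) (A t) (frameComb A t ξ η ζ) = η ∧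
    tripleCoord (deriv (deriv A) t) (A t) (deriv A t) (frameComb A t ξ η ζ) = ζ := by
  have h1 := h.triple_ne t ht
  have h2 := h1
  rw [triple_product_permutation] at h2
  have h3 := h2
  rw [triple_product_permutation] at h3
  simp only [frameComb, map_add, map_smul, tripleCoord_self h1, tripleCoord_self h2,
    tripleCoord_self h3, tripleCoord_second, tripleCoord_third, smul_eq_mul]
  refine ⟨?_, ?_, ?_⟩ <;> ring

theorem comb_inj (h : MovingFrame C A a b c I) (ht : t ∈ I) {ξ η ζ ξ' η' ζ' : ℝ}
    (he : frameComb A t ξ η ζ = frameComb A t ξ' η' ζ') : ξ = ξ' ∧ η = η' ∧ ζ = ζ' := by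
  obtain ⟨h1, h2, h3⟩ := h.coord_comb ht ξ η ζ
  obtain ⟨h1', h2', h3'⟩ := h.coord_comb ht ξ' η' ζ'
  rw [he] at h1 h2 h3
  exact ⟨h1.symm.trans h1', h2.symm.trans h2', h3.symm.trans h3'⟩

theorem comb_eq_zero_iff (h : MovingFrame C A a b c I) (ht : t ∈ I) {ξ η ζ : ℝ} :
    frameComb A t ξ η ζ = 0 ↔ ξ = 0 ∧ η = 0 ∧ ζ = 0 := by
  constructor
  · intro he
    exact h.comb_inj ht (he.trans (show (0 : R3) = frameComb A t 0 0 0 by simp [frameComb]))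
  · rintro ⟨rfl, rfl, rfl⟩
    simp [frameComb]

theorem exists_comb (h : MovingFrame C A a b c I) (ht : t ∈ I) (w : R3) :
    ∃ ξ η ζ, w = frameComb A t ξ η ζ :=
  ⟨_, _, _, tripleCoord_expansion (h.triple_ne t ht) w⟩

/-- The product rule, with `A'''` expanded again in the frame. -/
theorem hasDerivAt_comb (h : MovingFrame C A a b c I) (ht : t ∈ I) {ξ η ζ : ℝ → ℝ} {ξ' η' ζ' : ℝ}
    (hξ : HasDerivAt ξ ξ' t) (hη : HasDerivAt η η' t) (hζ : HasDerivAt ζ ζ' t) :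
    HasDerivAt (fun s => frameComb A s (ξ s) (η s) (ζ s))
      (frameComb A t (ξ' + a t * ζ t) (ξ t + η' + b t * ζ t) (η t + ζ' + c t * ζ t)) t := by
  have h0 := h.smooth t ht
  have h1 := ((hξ.smul h0.hasDerivAt_infty).add (hη.smul h0.deriv_infty.hasDerivAt_infty)).add
    (hζ.smul h0.deriv_infty.deriv_infty.hasDerivAt_infty)
  refine h1.congr_deriv ?_
  rw [h.deriv_three t ht]
  simp only [frameComb]
  module

theorem exists_hasDerivAt_coord (h : MovingFrame C A a b c I) (ht : t ∈ I) {B : ℝ → R3} {B' : R3}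
    (hB : HasDerivAt B B' t) : ∃ ξ η ζ : ℝ → ℝ, ∃ ξ' η' ζ' : ℝ, HasDerivAt ξ ξ' t ∧
      HasDerivAt η η' t ∧ HasDerivAt ζ ζ' t ∧
      ∀ s ∈ I, B s = frameComb A s (ξ s) (η s) (ζ s) := by
  have h0 := (h.smooth t ht).hasDerivAt_infty
  have h1 := (h.smooth t ht).deriv_infty.hasDerivAt_infty
  have h2 := (h.smooth t ht).deriv_infty.deriv_infty.hasDerivAt_infty
  have e1 := h.triple_ne t ht
  have e2 := e1
  rw [triple_product_permutation] at e2
  have e3 := e2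
  rw [triple_product_permutation] at e3
  exact ⟨_, _, _, _, _, _, (hB.dot (h1.cross h2)).div (h0.dot (h1.cross h2)) e1,
    (hB.dot (h2.cross h0)).div (h1.dot (h2.cross h0)) e2,
    (hB.dot (h0.cross h1)).div (h2.dot (h0.cross h1)) e3,
    fun s hs => tripleCoord_expansion (h.triple_ne s hs) (B s)⟩

end MovingFrame

/-! ### Osculating conics -/

theorem hasDerivAt_bilin (B : LinearMap.BilinForm ℝ R3) {u v : ℝ → R3} {u' v' : R3} {t : ℝ}
    (hu : HasDerivAt u u' t) (hv : HasDerivAt v v' t) :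
    HasDerivAt (fun s => B (u s) (v s)) (B u' (v t) + B (u t) v') t := by
  have h := (LinearMap.toContinuousBilinearMap B).hasFDerivAt_of_bilinear hu.hasFDerivAt
    hv.hasFDerivAt
  refine h.hasDerivAt.congr_deriv ?_
  simp [add_comm]

/-- The five expressions are `B(A, A)` and its first four derivatives, up to a factor `2`. -/
theorem bilin_isBigO_iff {B : LinearMap.BilinForm ℝ R3} (hB : ∀ u v, B u v = B v u)
    {A A1 A2 A3 A4 : ℝ → R3} {t : ℝ} (h0 : ∀ᶠ s in 𝓝 t, HasDerivAt A (A1 s) s)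
    (h1 : ∀ᶠ s in 𝓝 t, HasDerivAt A1 (A2 s) s) (h2 : ∀ᶠ s in 𝓝 t, HasDerivAt A2 (A3 s) s)
    (h3 : ∀ᶠ s in 𝓝 t, HasDerivAt A3 (A4 s) s) (h4 : DifferentiableAt ℝ A4 t) :
    ((fun s => B (A s) (A s)) =O[𝓝 t] fun s => (s - t) ^ 5) ↔
      B (A t) (A t) = 0 ∧ B (A t) (A1 t) = 0 ∧ B (A t) (A2 t) + B (A1 t) (A1 t) = 0 ∧
      B (A t) (A3 t) + 3 * B (A1 t) (A2 t) = 0 ∧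
      B (A t) (A4 t) + 4 * B (A1 t) (A3 t) + 3 * B (A2 t) (A2 t) = 0 := by
  set f : ℕ → ℝ → ℝ := fun k s => match k with
    | 0 => B (A s) (A s)
    | 1 => 2 * B (A s) (A1 s)
    | 2 => 2 * (B (A s) (A2 s) + B (A1 s) (A1 s))
    | 3 => 2 * (B (A s) (A3 s) + 3 * B (A1 s) (A2 s))
    | _ => 2 * (B (A s) (A4 s) + 4 * B (A1 s) (A3 s) + 3 * B (A2 s) (A2 s)) with hf
  have key := isBigO_pow_iff (t := t) (n := 4) (f := f) (by
    intro k hk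
    filter_upwards [h0, h1, h2, h3] with s k0 k1 k2 k3
    interval_cases k
    · refine (hasDerivAt_bilin B k0 k0).congr_deriv ?_
      simp only [hf]
      rw [hB (A1 s) (A s)]
      ring
    · refine ((hasDerivAt_bilin B k0 k1).const_mul 2).congr_deriv ?_
      simp only [hf]
      ring
    · refine (((hasDerivAt_bilin B k0 k2).add
        (hasDerivAt_bilin B k1 k1)).const_mul 2).congr_deriv ?_
      simp only [hf]
      rw [hB (A2 s) (A1 s)]
      ring
    · refine (((hasDerivAt_bilin B k0 k3).add
        ((hasDerivAt_bilin B k1 k2).const_mul 3)).const_mul 2).congr_deriv ?_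
      simp only [hf]
      ring) (by
    have k0 := h0.self_of_nhds
    have k1 := h1.self_of_nhds
    have k2 := h2.self_of_nhds
    have k3 := h3.self_of_nhds
    exact ((((hasDerivAt_bilin B k0 h4.hasDerivAt).add
      ((hasDerivAt_bilin B k1 k3).const_mul 4)).add
      ((hasDerivAt_bilin B k2 k2).const_mul 3)).const_mul 2).differentiableAt)
  refine key.trans ⟨fun h => ?_, fun h k hk => ?_⟩
  · have e0 := h 0 (by norm_num)
    have e1 := h 1 (by norm_num)
    have e2 := h 2 (by norm_num)
    have e3 := h 3 (by norm_num)
    have e4 := h 4 (by norm_num)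
    simp only [hf, mul_eq_zero, two_ne_zero, false_or] at e0 e1 e2 e3 e4
    exact ⟨e0, e1, e2, e3, e4⟩
  · obtain ⟨e0, e1, e2, e3, e4⟩ := h
    interval_cases k <;> simp only [hf, e0, e1, e2, e3, e4, mul_zero]

/-! ### Osculating conics and developments in a moving frame -/

namespace MovingFrame

variable {C : ℝ → Plane} {A : ℝ → R3} {a b c : ℝ → ℝ} {I : Set ℝ} {t : ℝ}

/-- Another lift multiplies `F(A)` by the square of a continuous factor, which keeps the order of
vanishing. -/
theorem isOsculatingConic_iff_isBigO (h : MovingFrame C A a b c I) (ht : t ∈ I)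
    (F : QuadraticForm ℝ R3) :
    IsOsculatingConic C t F ↔ F ≠ 0 ∧ (fun s => F (A s)) =O[𝓝 t] fun s => (s - t) ^ 5 := by
  refine and_congr_right fun _ => ⟨?_, fun hO => ⟨A, h.isSmoothLift ht, hO⟩⟩
  rintro ⟨D, hD, hO⟩
  obtain ⟨μ, hμ⟩ := hD.1.exists_factor (h.isLiftNear ht)
  have hμc := (hD.2.factor (h.smooth t ht) hD.1.ne_zero hμ).continuousAt
  have h1 : (fun s => μ s * μ s) =O[𝓝 t] fun _ => (1 : ℝ) := (hμc.mul hμc).isBigO_one ℝ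
  have h2 := h1.mul hO
  refine (h2.congr' ?_ ?_)
  · filter_upwards [hμ] with s hs
    rw [hs.2, QuadraticMap.map_smul, smul_eq_mul]
  · exact Eventually.of_forall fun s => one_mul _

/-- The five conditions are triangular and determine the Gram matrix of `B` in the frame from `B(A',
A')`; this is the uniqueness of the osculating conic up to scale. The coefficient `a` drops out, as
it only multiplies `B(A, A)` and `B(A, A')`. -/
theorem bilin_isBigO_iff_coord (h : MovingFrame C A a b c I) (ht : t ∈ I)
    {B : LinearMap.BilinForm ℝ R3} (hB : ∀ u v, B u v = B v u) :
    ((fun s => B (A s) (A s)) =O[𝓝 t] fun s => (s - t) ^ 5) ↔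
      B (A t) (A t) = 0 ∧ B (A t) (deriv A t) = 0 ∧
      B (A t) (deriv (deriv A) t) = -B (deriv A t) (deriv A t) ∧
      B (deriv A t) (deriv (deriv A) t) = c t / 3 * B (deriv A t) (deriv A t) ∧
      B (deriv (deriv A) t) (deriv (deriv A) t) =
        (deriv c t / 3 - c t ^ 2 / 9 - b t) * B (deriv A t) (deriv A t) := by
  have hI := h.isOpen.mem_nhds ht
  have hs := h.smooth t ht
  have h4 : deriv (deriv (deriv (deriv A))) t =
      frameComb A t (deriv a t + a t * c t) (a t + deriv b t + b t * c t)
        (b t + deriv c t + c t * c t) := by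
    have h1 := h.hasDerivAt_comb ht (h.smooth_a t ht).hasDerivAt_infty
      (h.smooth_b t ht).hasDerivAt_infty (h.smooth_c t ht).hasDerivAt_infty
    exact (h1.congr_of_eventuallyEq
      (by filter_upwards [hI] with s hs using h.deriv_three s hs)).deriv
  rw [bilin_isBigO_iff hB (A1 := deriv A) (A2 := deriv (deriv A)) (A3 := deriv (deriv (deriv A)))
    (A4 := deriv (deriv (deriv (deriv A))))
    (by filter_upwards [hI] with s hs using (h.smooth s hs).hasDerivAt_infty)
    (by filter_upwards [hI] with s hs using (h.smooth s hs).deriv_infty.hasDerivAt_infty)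
    (by filter_upwards [hI] with s hs using
      (h.smooth s hs).deriv_infty.deriv_infty.hasDerivAt_infty)
    (by filter_upwards [hI] with s hs using
      (h.smooth s hs).deriv_infty.deriv_infty.deriv_infty.hasDerivAt_infty)
    hs.deriv_infty.deriv_infty.deriv_infty.deriv_infty.hasDerivAt_infty.differentiableAt,
    h4, h.deriv_three t ht]
  simp only [frameComb, map_add, map_smul, smul_eq_mul]
  rw [hB (deriv A t) (A t)]
  refine and_congr_right fun e0 => and_congr_right fun e1 => ?_
  rw [e0, e1]
  constructor
  · rintro ⟨e2, e3, e4⟩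
    have k2 : B (A t) (deriv (deriv A) t) = -B (deriv A t) (deriv A t) := by linarith
    rw [k2] at e3 e4
    have k3 : B (deriv A t) (deriv (deriv A) t) = c t / 3 * B (deriv A t) (deriv A t) := by linarith
    rw [k3] at e4
    exact ⟨k2, k3, by linear_combination e4 / 3⟩
  · rintro ⟨e2, e3, e4⟩
    rw [e2, e3, e4]
    refine ⟨?_, ?_, ?_⟩ <;> ring

/-- The equation of the osculating conic in the coordinates of the moving frame. -/
theorem onOsculatingConic_iff (h : MovingFrame C A a b c I) (ht : t ∈ I) {x : Plane} {ξ η ζ : ℝ}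
    (hX0 : frameComb A t ξ η ζ ≠ 0) (hX : frameComb A t ξ η ζ ∈ x.submodule) :
    OnOsculatingConic C t x ↔
      η ^ 2 - 2 * ξ * ζ + 2 * c t / 3 * η * ζ +
        (deriv c t / 3 - c t ^ 2 / 9 - b t) * ζ ^ 2 = 0 := by
  have hval : ∀ B : LinearMap.BilinForm ℝ R3, (∀ u v, B u v = B v u) →
      ((fun s => B (A s) (A s)) =O[𝓝 t] fun s => (s - t) ^ 5) → ∀ ξ η ζ,
      B (frameComb A t ξ η ζ) (frameComb A t ξ η ζ) = B (deriv A t) (deriv A t) *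
        (η ^ 2 - 2 * ξ * ζ + 2 * c t / 3 * η * ζ +
          (deriv c t / 3 - c t ^ 2 / 9 - b t) * ζ ^ 2) := by
    intro B hB hO ξ η ζ
    obtain ⟨e0, e1, e2, e3, e4⟩ := (h.bilin_isBigO_iff_coord ht hB).1 hO
    simp only [frameComb, map_add, map_smul, LinearMap.add_apply, LinearMap.smul_apply, smul_eq_mul]
    rw [hB (deriv A t) (A t), hB (deriv (deriv A) t) (A t), hB (deriv (deriv A) t) (deriv A t),
      e0, e1, e2, e3, e4]
    ring
  constructor
  · rintro ⟨F, hF, hFx⟩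
    obtain ⟨hF0, hO⟩ := (h.isOsculatingConic_iff_isBigO ht F).1 hF
    have hself : ∀ v, QuadraticMap.associated (R := ℝ) F v v = F v :=
      fun v => QuadraticMap.associated_eq_self_apply ℝ F v
    have hsym : ∀ u v, QuadraticMap.associated (R := ℝ) F u v = QuadraticMap.associated F v u :=
      fun u v => QuadraticMap.associated_isSymm ℝ F u v
    have hv := hval (QuadraticMap.associated F) hsym (by simpa only [hself] using hO)
    have h1 := hv ξ η ζ
    rw [hself, hFx _ hX] at h1
    -- If `B(A', A')` vanished, the whole Gram matrix would, and `F` would be zero.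
    refine (mul_eq_zero.1 h1.symm).resolve_left fun h0 => hF0 ?_
    ext w
    obtain ⟨x, y, z, rfl⟩ := h.exists_comb ht w
    rw [← hself, hv, h0, zero_mul]
    rfl
  · intro hconic
    set e0 := tripleCoord (A t) (deriv A t) (deriv (deriv A) t)
    set e1 := tripleCoord (deriv A t) (deriv (deriv A) t) (A t)
    set e2 := tripleCoord (deriv (deriv A) t) (A t) (deriv A t)
    -- The form with the prescribed Gram matrix, normalized by `B(A', A') = 1`.
    let B : LinearMap.BilinForm ℝ R3 := LinearMap.mk₂ ℝ
      (fun u v => e1 u * e1 v - (e0 u * e2 v + e2 u * e0 v) +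
        c t / 3 * (e1 u * e2 v + e2 u * e1 v) +
        (deriv c t / 3 - c t ^ 2 / 9 - b t) * (e2 u * e2 v))
      (by intros; simp only [map_add]; ring) (by intros; simp only [map_smul, smul_eq_mul]; ring)
      (by intros; simp only [map_add]; ring) (by intros; simp only [map_smul, smul_eq_mul]; ring)
    have hBapp : ∀ u v, B u v = e1 u * e1 v - (e0 u * e2 v + e2 u * e0 v) +
        c t / 3 * (e1 u * e2 v + e2 u * e1 v) +
        (deriv c t / 3 - c t ^ 2 / 9 - b t) * (e2 u * e2 v) := fun _ _ => rfl
    have hsym : ∀ u v, B u v = B v u := fun u v => by rw [hBapp, hBapp]; ring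
    have c0 := h.coord_comb ht 1 0 0
    have c1 := h.coord_comb ht 0 1 0
    have c2 := h.coord_comb ht 0 0 1
    simp only [frameComb, one_smul, zero_smul, add_zero, zero_add] at c0 c1 c2
    have hO : (fun s => B (A s) (A s)) =O[𝓝 t] fun s => (s - t) ^ 5 := by
      rw [h.bilin_isBigO_iff_coord ht hsym]
      simp only [hBapp]
      rw [c0.1, c0.2.1, c0.2.2, c1.1, c1.2.1, c1.2.2, c2.1, c2.2.1, c2.2.2]
      refine ⟨?_, ?_, ?_, ?_, ?_⟩ <;> ring
    have hB11 : B (deriv A t) (deriv A t) = 1 := by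
      rw [hBapp, c1.1, c1.2.1, c1.2.2]; ring
    refine ⟨B.toQuadraticMap, (h.isOsculatingConic_iff_isBigO ht _).2 ⟨fun h0 => ?_, hO⟩, ?_⟩
    · have := congrArg (fun G : QuadraticForm ℝ R3 => G (deriv A t)) h0
      simp only [LinearMap.BilinMap.toQuadraticMap_apply, hB11, zero_apply] at this
      exact one_ne_zero this
    · intro w hw
      obtain ⟨k, rfl⟩ := (mem_iff_smul hX0 hX).1 hw
      rw [QuadraticMap.map_smul, LinearMap.BilinMap.toQuadraticMap_apply, hval B hsym hO, hconic,
        mul_zero, smul_zero]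

/-- The condition on the velocity of a development, in the coordinates of the moving frame. -/
theorem exists_velocity_iff (h : MovingFrame C A a b c I) (ht : t ∈ I) {x : ℝ → Plane} :
    (∃ v, HasVelocityAt x t v ∧ lineOf v ≤ (x t).submodule ⊔ (C t).submodule) ↔
      ∃ ξ η ζ : ℝ → ℝ, ∃ ξ' η' ζ' μ : ℝ, HasDerivAt ξ ξ' t ∧ HasDerivAt η η' t ∧
        HasDerivAt ζ ζ' t ∧ (∀ᶠ s in 𝓝 t, frameComb A s (ξ s) (η s) (ζ s) ≠ 0 ∧
          frameComb A s (ξ s) (η s) (ζ s) ∈ (x s).submodule) ∧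
        ξ t + η' + b t * ζ t = μ * η t ∧ η t + ζ' + c t * ζ t = μ * ζ t := by
  have hI := h.isOpen.mem_nhds ht
  obtain ⟨hA0, hAC⟩ := h.lift t ht
  constructor
  · rintro ⟨v, ⟨B, B', hB, hB', hv⟩, hle⟩
    obtain ⟨ξ, η, ζ, ξ', η', ζ', hξ, hη, hζ, heq⟩ := h.exists_hasDerivAt_coord ht hB'
    have hmem : B' ∈ (x t).submodule ⊔ (C t).submodule := hle (hv.mem_lineOf.2 ⟨0, 1, by simp⟩)
    rw [submodule_eq_span hB.ne_zero hB.mem, submodule_eq_span hA0 hAC] at hmem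
    obtain ⟨y, hy, z, hz, hyz⟩ := Submodule.mem_sup.1 hmem
    obtain ⟨μ, rfl⟩ := Submodule.mem_span_singleton.1 hy
    obtain ⟨ν, rfl⟩ := Submodule.mem_span_singleton.1 hz
    have h1 := (h.hasDerivAt_comb ht hξ hη hζ).congr_of_eventuallyEq
      (by filter_upwards [hI] with s hs using heq s hs)
    -- The coordinate along `A` is absorbed by the free multiple `ν` of `A`, so only the other two
    -- give conditions.
    have h2 : frameComb A t (ξ' + a t * ζ t) (ξ t + η' + b t * ζ t) (η t + ζ' + c t * ζ t) =
        frameComb A t (μ * ξ t + ν) (μ * η t) (μ * ζ t) := by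
      rw [← hB'.unique h1, ← hyz, heq t ht]
      simp only [frameComb]
      module
    obtain ⟨_, h3, h4⟩ := h.comb_inj ht h2
    refine ⟨ξ, η, ζ, ξ', η', ζ', μ, hξ, hη, hζ, ?_, h3, h4⟩
    filter_upwards [hI, hB] with s hs hs'
    rwa [← heq s hs]
  · rintro ⟨ξ, η, ζ, ξ', η', ζ', μ, hξ, hη, hζ, hX, h3, h4⟩
    have h1 := h.hasDerivAt_comb ht hξ hη hζ
    obtain ⟨v, hv⟩ := exists_isDPi hX.self_of_nhds.1 hX.self_of_nhds.2
      (frameComb A t (ξ' + a t * ζ t) (ξ t + η' + b t * ζ t) (η t + ζ' + c t * ζ t))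
    refine ⟨v, ⟨_, _, hX, h1, hv⟩, fun y hy => ?_⟩
    obtain ⟨k, l, rfl⟩ := hv.mem_lineOf.1 hy
    have h5 : frameComb A t (ξ' + a t * ζ t) (ξ t + η' + b t * ζ t) (η t + ζ' + c t * ζ t) =
        μ • frameComb A t (ξ t) (η t) (ζ t) + (ξ' + a t * ζ t - μ * ξ t) • A t := by
      rw [h3, h4]
      simp only [frameComb]
      module
    rw [h5]
    exact Submodule.add_mem _ (Submodule.smul_mem _ _ (Submodule.mem_sup_left hX.self_of_nhds.2))
      (Submodule.smul_mem _ _ (Submodule.add_mem _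
        (Submodule.smul_mem _ _ (Submodule.mem_sup_left hX.self_of_nhds.2))
        (Submodule.smul_mem _ _ (Submodule.mem_sup_right hAC))))

end MovingFrame


/-! ### Stereographic projection in the coordinates of the moving frame -/

namespace MovingFrame

variable {C : ℝ → Plane} {A : ℝ → R3} {a b c : ℝ → ℝ} {I : Set ℝ} {t : ℝ}

theorem tang_eq_zero_iff (h : MovingFrame C A a b c I) (ht : t ∈ I) {v : Tang (C t)} {w y z : ℝ}
    (hv : IsDPi (A t) (frameComb A t w y z) v) : v = 0 ↔ y = 0 ∧ z = 0 := by
  rw [hv.eq_zero_iff, cross_eq_zero_iff hv.ne_zero]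
  constructor
  · rintro ⟨k, hk⟩
    obtain ⟨_, h1, h2⟩ := h.comb_inj ht
      (show frameComb A t k 0 0 = frameComb A t w y z by rw [← hk]; simp [frameComb])
    exact ⟨h1.symm, h2.symm⟩
  · rintro ⟨rfl, rfl⟩
    exact ⟨w, by simp [frameComb]⟩

theorem comb_mem_lineOf_iff (h : MovingFrame C A a b c I) (ht : t ∈ I) {v : Tang (C t)}
    {w y z ξ η ζ : ℝ} (hv : IsDPi (A t) (frameComb A t w y z) v) (h0 : v ≠ 0) :
    frameComb A t ξ η ζ ∈ lineOf v ↔ η * z = ζ * y := by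
  rw [ne_eq, h.tang_eq_zero_iff ht hv] at h0
  rw [hv.mem_lineOf]
  constructor
  · rintro ⟨k, l, hkl⟩
    have h1 : frameComb A t ξ η ζ = frameComb A t (k + l * w) (l * y) (l * z) := by
      rw [hkl]
      simp only [frameComb]
      module
    obtain ⟨_, rfl, rfl⟩ := h.comb_inj ht h1
    ring
  · intro he
    obtain ⟨l, rfl, rfl⟩ : ∃ l, η = l * y ∧ ζ = l * z := by
      by_cases hy : y = 0
      · have hz : z ≠ 0 := fun hz => h0 ⟨hy, hz⟩
        refine ⟨ζ / z, ?_, by field_simp⟩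
        rw [hy, mul_zero] at he ⊢
        exact (mul_eq_zero.1 he).resolve_right hz
      · exact ⟨η / y, by field_simp, by field_simp; linarith⟩
    refine ⟨ξ - l * w, l, ?_⟩
    simp only [frameComb]
    module

theorem lineOf_eq_iff (h : MovingFrame C A a b c I) (ht : t ∈ I) {v v' : Tang (C t)}
    {w y z w' y' z' : ℝ} (hv : IsDPi (A t) (frameComb A t w y z) v) (h0 : v ≠ 0)
    (hv' : IsDPi (A t) (frameComb A t w' y' z') v') (h0' : v' ≠ 0) :
    lineOf v = lineOf v' ↔ y' * z = z' * y := by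
  constructor
  · intro he
    rw [← h.comb_mem_lineOf_iff ht (ξ := w') hv h0, he]
    exact hv'.mem_lineOf.2 ⟨0, 1, by simp⟩
  · intro he
    rw [ne_eq, h.tang_eq_zero_iff ht hv, not_and_or] at h0
    rw [ne_eq, h.tang_eq_zero_iff ht hv', not_and_or] at h0'
    ext r
    obtain ⟨ξ, η, ζ, rfl⟩ := h.exists_comb ht r
    rw [h.comb_mem_lineOf_iff ht hv (by rwa [ne_eq, h.tang_eq_zero_iff ht hv, not_and_or]),
      h.comb_mem_lineOf_iff ht hv' (by rwa [ne_eq, h.tang_eq_zero_iff ht hv', not_and_or])]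
    constructor
    · intro hr
      rcases h0 with hy | hz
      · apply mul_right_cancel₀ hy; linear_combination y' * hr - η * he
      · apply mul_right_cancel₀ hz; linear_combination z' * hr - ζ * he
    · intro hr
      rcases h0' with hy | hz
      · apply mul_right_cancel₀ hy; linear_combination y * hr + η * he
      · apply mul_right_cancel₀ hz; linear_combination z * hr + ζ * he

/-- Modulo `A`, the line to `(ξ, η, ζ)` has direction `(η : ζ)`. At the contact point this is `(0 :
0)`, and the condition `z = 0` selects the tangent. The hypothesis `hη` holds on the osculating
conic, whose equation at `ζ = 0` is `η² = 0`. -/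
theorem isStereographic_iff (h : MovingFrame C A a b c I) (ht : t ∈ I) {x : Plane}
    {u : ℙ ℝ (Tang (C t))} {v : Tang (C t)} {w y z ξ η ζ : ℝ} (hu : lineOf u.rep = lineOf v)
    (h0 : v ≠ 0) (hv : IsDPi (A t) (frameComb A t w y z) v)
    (hX0 : frameComb A t ξ η ζ ≠ 0) (hX : frameComb A t ξ η ζ ∈ x.submodule)
    (hη : ζ = 0 → η = 0) :
    IsStereographic C t x u ↔ (ζ = 0 → z = 0) ∧ η * z = ζ * y := by
  obtain ⟨hA0, hAC⟩ := h.lift t ht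
  have hxC : x = C t ↔ ζ = 0 := by
    rw [eq_mk_of_mem hX0 hX, eq_mk_of_mem hA0 hAC, Projectivization.mk_eq_mk_iff']
    constructor
    · rintro ⟨k, hk⟩
      exact (h.comb_inj ht (show frameComb A t ξ η ζ = frameComb A t k 0 0 by
        rw [← hk]; simp [frameComb])).2.2
    · intro hz
      exact ⟨ξ, by rw [hη hz, hz]; simp [frameComb]⟩
  rw [IsStereographic, hu, ne_eq, hxC]
  by_cases hζ : ζ = 0
  · obtain ⟨v₁, hv₁⟩ := exists_isDPi hA0 hAC (deriv A t)
    have hv₁' : IsDPi (A t) (frameComb A t 0 1 0) v₁ := by simpa [frameComb] using hv₁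
    have h1 : v₁ ≠ 0 := by
      rw [ne_eq, h.tang_eq_zero_iff ht hv₁']; simp
    have h2 := h.lineOf_eq_iff ht hv h0 hv₁' h1
    rw [one_mul, zero_mul] at h2
    have hvel : ∀ v', HasVelocityAt C t v' ↔ v' = v₁ := fun v' => by
      rw [hasVelocityAt_iff (h.isLiftNear ht) (h.smooth t ht).hasDerivAt_infty]
      exact ⟨fun h' => h'.unique hv₁, fun h' => h' ▸ hv₁⟩
    simp only [hζ, not_true_eq_false, false_implies, true_and, forall_const, hvel,
      exists_eq_left, h2, hη hζ, zero_mul, and_true]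
  · simp only [hζ, not_false_eq_true, forall_const, false_implies, and_true, true_and]
    obtain ⟨v₁, hv₁⟩ := exists_isDPi hA0 hAC (frameComb A t ξ η ζ)
    have h1 : v₁ ≠ 0 := by
      rw [ne_eq, h.tang_eq_zero_iff ht hv₁]; exact fun h' => hζ h'.2
    have h2 : lineOf v₁ = x.submodule ⊔ (C t).submodule := by
      rw [hv₁.lineOf_eq, Submodule.span_insert, sup_comm, submodule_eq_span hX0 hX,
        submodule_eq_span hA0 hAC]
    rw [← h2, h.lineOf_eq_iff ht hv h0 hv₁ h1]

end MovingFrame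

/-! ### The moving frames of the two curves of a rolling -/

theorem triple_product_lift (μ μ' μ'' : ℝ) (A A' A'' : R3) :
    (μ • A) ⬝ᵥ (μ • A' + μ' • A) ⨯₃ ((μ • A'' + μ' • A') + (μ' • A' + μ'' • A)) =
      μ ^ 3 * (A ⬝ᵥ A' ⨯₃ A'') := by
  simp only [dot_expand, cross_apply_zero, cross_apply_one, cross_apply_two, Pi.add_apply,
    Pi.smul_apply, smul_eq_mul]
  ring

/-- The Wronskian of `μA` is `μ³` times that of `A`, so local convexity may be tested on the lift
given by `Γ`. -/
theorem LocallyConvexOn.triple_ne {C : ℝ → Plane} {I : Set ℝ} (h : LocallyConvexOn C I) {t : ℝ}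
    (ht : t ∈ I) {Q : ℝ → R3} (hQ : IsLiftNear C Q t) (hQs : ContDiffAt ℝ ∞ Q t) :
    Q t ⬝ᵥ deriv Q t ⨯₃ deriv (deriv Q) t ≠ 0 := by
  obtain ⟨A, hA, hind⟩ := h t ht
  rw [linearIndependent_iff_triple] at hind
  obtain ⟨μ, hμ⟩ := hA.1.exists_factor hQ
  have hμs := hA.2.factor hQs hA.1.ne_zero hμ
  have hQe : Q =ᶠ[𝓝 t] fun s => μ s • A s := by filter_upwards [hμ] with s hs using hs.2
  have h1 : deriv Q =ᶠ[𝓝 t] fun s => μ s • deriv A s + deriv μ s • A s := by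
    have e1 := (hA.2.of_le (m := 1) (by norm_cast)).eventually (by norm_num)
    have e2 := (hμs.of_le (m := 1) (by norm_cast)).eventually (by norm_num)
    filter_upwards [hQe.eventuallyEq_nhds, e1, e2] with s hs k1 k2
    rw [hs.deriv_eq]
    exact ((k2.differentiableAt one_ne_zero).hasDerivAt.smul
      (k1.differentiableAt one_ne_zero).hasDerivAt).deriv
  have h2 : deriv (deriv Q) t = (μ t • deriv (deriv A) t + deriv μ t • deriv A t) +
      (deriv μ t • deriv A t + deriv (deriv μ) t • A t) := by
    rw [h1.deriv_eq]
    exact ((hμs.hasDerivAt_infty.smul hA.2.deriv_infty.hasDerivAt_infty).add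
      (hμs.deriv_infty.hasDerivAt_infty.smul hA.2.hasDerivAt_infty)).deriv
  rw [hQe.self_of_nhds, h1.self_of_nhds, h2, triple_product_lift]
  exact mul_ne_zero (pow_ne_zero _ hμ.self_of_nhds.1) hind

theorem LocallyConvexOn.exists_movingFrame {C : ℝ → Plane} {I : Set ℝ} (h : LocallyConvexOn C I)
    (hI : IsOpen I) {Q : ℝ → R3} (hQ : ∀ t ∈ I, Q t ≠ 0 ∧ Q t ∈ (C t).submodule)
    (hQs : ∀ t ∈ I, ContDiffAt ℝ ∞ Q t) : ∃ a b c, MovingFrame C Q a b c I := by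
  have htr : ∀ t ∈ I, Q t ⬝ᵥ deriv Q t ⨯₃ deriv (deriv Q) t ≠ 0 := fun t ht =>
    h.triple_ne ht (by filter_upwards [hI.mem_nhds ht] with s hs using hQ s hs) (hQs t ht)
  refine ⟨fun t => tripleCoord (Q t) (deriv Q t) (deriv (deriv Q) t) (deriv (deriv (deriv Q)) t),
    fun t => tripleCoord (deriv Q t) (deriv (deriv Q) t) (Q t) (deriv (deriv (deriv Q)) t),
    fun t => tripleCoord (deriv (deriv Q) t) (Q t) (deriv Q t) (deriv (deriv (deriv Q)) t),
    hI, hQ, hQs, htr, fun t ht => ?_, fun t ht => ?_, fun t ht => ?_,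
    fun t ht => tripleCoord_expansion (htr t ht) _⟩
  all_goals
    have h0 := hQs t ht
    have h1 := h0.deriv_infty
    have h2 := h1.deriv_infty
    have h3 := h2.deriv_infty
    have e1 := htr t ht
    have e2 := e1
    rw [triple_product_permutation] at e2
    have e3 := e2
    rw [triple_product_permutation] at e3
  · exact (h3.dot (h1.cross h2)).div (h0.dot (h1.cross h2)) e1
  · exact (h3.dot (h2.cross h0)).div (h1.dot (h2.cross h0)) e2
  · exact (h3.dot (h0.cross h1)).div (h2.dot (h0.cross h1)) e3

/-- Applied to `p, p', p''`: as `p · q = 1`, the dual curve has the same Wronskian as `q`. -/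
theorem triple_product_dual (q q₁ q₂ p : R3) (l k : ℝ) :
    p ⬝ᵥ (q ⨯₃ q₁ + l • p) ⨯₃ (q ⨯₃ q₂ + l • q ⨯₃ q₁ + k • p) =
      (q ⬝ᵥ q₁ ⨯₃ q₂) * (p ⬝ᵥ q) := by
  simp only [dot_expand, cross_apply_zero, cross_apply_one, cross_apply_two, Pi.add_apply,
    Pi.smul_apply, smul_eq_mul]
  ring

/-- A curve `q` in `ℝ³` and a curve `p` in `(ℝ³)*` with `p q = 1` and
`p' = q × q' + l p`, where `q` has the moving frame `q, q', q''`. -/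
structure SlipFreePair (C D : ℝ → Plane) (Q P : ℝ → R3) (a b c l : ℝ → ℝ) (I : Set ℝ) : Prop where
  frame : MovingFrame C Q a b c I
  lift : ∀ t ∈ I, P t ≠ 0 ∧ P t ∈ (D t).submodule
  smooth : ∀ t ∈ I, ContDiffAt ℝ ∞ P t
  smooth_l : ∀ t ∈ I, ContDiffAt ℝ ∞ l t
  dot_eq_one : ∀ t ∈ I, P t ⬝ᵥ Q t = 1
  dot_deriv : ∀ t ∈ I, P t ⬝ᵥ deriv Q t = -l t
  deriv_eq : ∀ t ∈ I, deriv P t = Q t ⨯₃ deriv Q t + l t • P t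

/-! ### The dual frame of a slip-free pair -/

namespace SlipFreePair

variable {C D : ℝ → Plane} {Q P : ℝ → R3} {a b c l : ℝ → ℝ} {I : Set ℝ} {t : ℝ}

theorem dot_deriv_two (h : SlipFreePair C D Q P a b c l I) (ht : t ∈ I) :
    P t ⬝ᵥ deriv (deriv Q) t = l t ^ 2 - deriv l t := by
  have h1 := (h.smooth t ht).hasDerivAt_infty.dot (h.frame.smooth t ht).deriv_infty.hasDerivAt_infty
  have h2 := h1.unique ((h.smooth_l t ht).hasDerivAt_infty.neg.congr_of_eventuallyEq
    (by filter_upwards [h.frame.isOpen.mem_nhds ht] with s hs using h.dot_deriv s hs))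
  rw [h.deriv_eq t ht, add_dotProduct, smul_dotProduct, h.dot_deriv t ht,
    dotProduct_comm (Q t ⨯₃ _), dot_cross_self, smul_eq_mul] at h2
  linarith

theorem deriv_two (h : SlipFreePair C D Q P a b c l I) (ht : t ∈ I) :
    deriv (deriv P) t = Q t ⨯₃ deriv (deriv Q) t + l t • Q t ⨯₃ deriv Q t +
      (deriv l t + l t ^ 2) • P t := by
  have hQ := (h.frame.smooth t ht).hasDerivAt_infty
  have hQ' := (h.frame.smooth t ht).deriv_infty.hasDerivAt_infty
  have h1 := (hQ.cross hQ').add ((h.smooth_l t ht).hasDerivAt_infty.smul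
    (h.smooth t ht).hasDerivAt_infty)
  have h2 := (h1.congr_of_eventuallyEq
    (by filter_upwards [h.frame.isOpen.mem_nhds ht] with s hs using h.deriv_eq s hs)).deriv
  rw [h2, cross_self, h.deriv_eq t ht]
  module

/-- `triple_expansion` with the values of `p` on `q, q', q''`. It eliminates the term `q' × q''`
from `p'''`. -/
theorem cross_deriv (h : SlipFreePair C D Q P a b c l I) (ht : t ∈ I) :
    deriv Q t ⨯₃ deriv (deriv Q) t = (Q t ⬝ᵥ deriv Q t ⨯₃ deriv (deriv Q) t) • P t +
      (deriv l t - l t ^ 2) • Q t ⨯₃ deriv Q t - l t • Q t ⨯₃ deriv (deriv Q) t := by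
  have h1 := triple_expansion (P t) (Q t) (deriv Q t) (deriv (deriv Q) t)
  rw [h.dot_eq_one t ht, h.dot_deriv t ht, h.dot_deriv_two ht, one_smul,
    ← cross_anticomm (Q t) (deriv (deriv Q) t)] at h1
  rw [← h1]
  module

/-- The moving frame of the curve `p`. -/
theorem exists_dual_frame (h : SlipFreePair C D Q P a b c l I) :
    ∃ a', MovingFrame D P a' (fun t => b t + 3 * deriv l t - c t * l t) c I := by
  have hI := h.frame.isOpen
  -- The value of this first coefficient plays no role later: conics and developments see only the
  -- other two.
  refine ⟨fun t => (Q t ⬝ᵥ deriv Q t ⨯₃ deriv (deriv Q) t) + deriv (deriv l) t +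
    2 * l t * deriv l t + l t * (deriv l t + l t ^ 2) -
    l t * (b t + 3 * deriv l t - c t * l t) - c t * (deriv l t + l t ^ 2),
    hI, h.lift, h.smooth, fun t ht => ?_, fun t ht => ?_, fun t ht => ?_, h.frame.smooth_c,
    fun t ht => ?_⟩
  · rw [h.deriv_eq t ht, h.deriv_two ht, triple_product_dual, h.dot_eq_one t ht, mul_one]
    exact h.frame.triple_ne t ht
  · have hQ := h.frame.smooth t ht
    have hl := h.smooth_l t ht
    have hb := h.frame.smooth_b t ht
    have hc := h.frame.smooth_c t ht
    have hl' := hl.deriv_infty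
    exact ((((((hQ.dot (hQ.deriv_infty.cross hQ.deriv_infty.deriv_infty)).add
      hl'.deriv_infty).add ((contDiffAt_const.mul hl).mul hl')).add
      (hl.mul (hl'.add (hl.pow 2)))).sub
      (hl.mul ((hb.add (contDiffAt_const.mul hl')).sub (hc.mul hl)))).sub
      (hc.mul (hl'.add (hl.pow 2))))
  · have hl := h.smooth_l t ht
    exact ((h.frame.smooth_b t ht).add (contDiffAt_const.mul hl.deriv_infty)).sub
      ((h.frame.smooth_c t ht).mul hl)
  · have hQ := (h.frame.smooth t ht).hasDerivAt_infty
    have hQ' := (h.frame.smooth t ht).deriv_infty.hasDerivAt_infty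
    have hQ'' := (h.frame.smooth t ht).deriv_infty.deriv_infty.hasDerivAt_infty
    have hl := (h.smooth_l t ht).hasDerivAt_infty
    have hl' := (h.smooth_l t ht).deriv_infty.hasDerivAt_infty
    have hP := (h.smooth t ht).hasDerivAt_infty
    have h1 := ((hQ.cross hQ'').add (hl.smul (hQ.cross hQ'))).add ((hl'.add (hl.pow 2)).smul hP)
    have h2 := (h1.congr_of_eventuallyEq
      (by filter_upwards [hI.mem_nhds ht] with s hs using h.deriv_two hs)).deriv
    rw [h2, h.frame.deriv_three t ht]
    simp only [frameComb]
    have hcd := h.cross_deriv ht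
    generalize Q t ⬝ᵥ deriv Q t ⨯₃ deriv (deriv Q) t = δ at hcd ⊢
    rw [h.deriv_two ht, h.deriv_eq t ht, hcd]
    simp only [map_add, map_smul, cross_self, smul_zero, zero_add, Pi.add_apply, Pi.pow_apply]
    module

/-- The action of `X ↦ q × X` in the moving frames. -/
theorem cross_comb (h : SlipFreePair C D Q P a b c l I) (ht : t ∈ I) (w y z : ℝ) :
    ∃ w', Q t ⨯₃ frameComb Q t w y z = frameComb P t w' (y - l t * z) z := by
  refine ⟨-(l t * y) + z * l t ^ 2 - z * (deriv l t + l t ^ 2), ?_⟩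
  simp only [frameComb]
  rw [h.deriv_two ht, h.deriv_eq t ht]
  simp only [map_add, map_smul, cross_self, smul_zero, zero_add]
  module

end SlipFreePair


/-! ### Integral curves and the no-slip condition -/

section Curves

variable {Γ : ℝ → Q5} {c : ℝ → PC} {I : Set ℝ} {t : ℝ}

theorem hasDerivAt_cov_dot_vec (h1 : ContDiffAt ℝ ∞ (fun s => (Γ s).vec) t)
    (h2 : ContDiffAt ℝ ∞ (fun s => (Γ s).cov) t) :
    deriv (fun s => (Γ s).cov) t ⬝ᵥ (Γ t).vec + (Γ t).cov ⬝ᵥ deriv (fun s => (Γ s).vec) t = 0 :=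
  (h2.hasDerivAt_infty.dot h1.hasDerivAt_infty).unique
    ((hasDerivAt_const t (1 : ℝ)).congr_of_eventuallyEq (Eventually.of_forall fun s => (Γ s).cov_dot_vec))

theorem isIntegralCurve_iff (hΓ : Q5.SmoothCurveOn Γ I) :
    IsIntegralCurve Γ I ↔ ∀ t ∈ I, deriv (fun s => (Γ s).cov) t =
      (Γ t).vec ⨯₃ deriv (fun s => (Γ s).vec) t := by
  refine forall₂_congr fun t ht => ?_
  obtain ⟨h1, h2⟩ := Q5.contDiffAt_iff.1 (hΓ t ht)
  have h3 : HasDerivAt (fun s => (Γ s).1)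
      (deriv (fun s => (Γ s).vec) t, deriv (fun s => (Γ s).cov) t) t :=
    h1.hasDerivAt_infty.prodMk h2.hasDerivAt_infty
  have hker : ∀ w : R3 × R3, w ∈ LinearMap.ker (oneForm (Γ t)) ↔ w.2 = (Γ t).vec ⨯₃ w.1 := by
    intro w
    rw [LinearMap.mem_ker, ← sub_eq_zero (a := w.2)]
    rfl
  constructor
  · rintro ⟨w, hw, hd⟩
    have h4 := (hker w).1 hw.2
    rwa [← h3.unique hd] at h4
  · intro h
    refine ⟨_, ⟨?_, (hker _).2 h⟩, h3⟩
    exact hasDerivAt_cov_dot_vec h1 h2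

/-- The tangent vectors `ψ q'` and `p'` are represented over `p` by `q × q'` and the derivative of
the covector, and representatives count modulo `p`. -/
theorem noSlip_iff (h : ∀ s, Corresponds (Γ s) (c s)) (hΓ : Q5.SmoothCurveOn Γ I) :
    NoSlip c I ↔ ∀ t ∈ I, ∃ l : ℝ, deriv (fun s => (Γ s).cov) t =
      (Γ t).vec ⨯₃ deriv (fun s => (Γ s).vec) t + l • (Γ t).cov := by
  refine forall₂_congr fun t ht => ?_
  obtain ⟨h1, h2⟩ := Q5.contDiffAt_iff.1 (hΓ t ht)
  have hq := fun v => hasVelocityAt_iff (v := v)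
    (Corresponds.isLiftNear_vec h t) h1.hasDerivAt_infty
  have hp := fun v => hasVelocityAt_iff (v := v)
    (Corresponds.isLiftNear_cov h t) h2.hasDerivAt_infty
  constructor
  · rintro ⟨v, hv, hv'⟩
    exact ((h t).2.2 _ _ ((hq v).1 hv)).congr_iff.1 ((hp _).1 hv')
  · intro hl
    obtain ⟨v, hv⟩ := exists_isDPi (Γ t).vec_ne_zero (h t).vec_mem (deriv (fun s => (Γ s).vec) t)
    exact ⟨v, (hq v).2 hv, (hp _).2 (((h t).2.2 _ _ hv).congr_iff.2 hl)⟩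

/-- Pairing `p' = q × q' + l p` with `q` gives `l = p' · q = -p · q'`, which is smooth in `t`. -/
theorem exists_slipFreePair (h : ∀ s, Corresponds (Γ s) (c s)) (hI : IsOpen I)
    (hΓ : Q5.SmoothCurveOn Γ I) (hc : LocallyConvexOn (fun t => (c t).q) I) (hs : NoSlip c I) :
    ∃ a b k, SlipFreePair (fun t => (c t).q) (fun t => (c t).p) (fun s => (Γ s).vec)
      (fun s => (Γ s).cov) a b k (fun s => -((Γ s).cov ⬝ᵥ deriv (fun s => (Γ s).vec) s)) I := by
  have h1 := fun t ht => (Q5.contDiffAt_iff.1 (hΓ t ht)).1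
  have h2 := fun t ht => (Q5.contDiffAt_iff.1 (hΓ t ht)).2
  obtain ⟨a, b, k, hF⟩ := hc.exists_movingFrame hI
    (fun t _ => ⟨(Γ t).vec_ne_zero, (h t).vec_mem⟩) h1
  refine ⟨a, b, k, hF, fun t _ => ⟨(Γ t).cov_ne_zero, (h t).cov_mem⟩, h2,
    fun t ht => ((h2 t ht).dot (h1 t ht).deriv_infty).neg, fun t _ => (Γ t).cov_dot_vec,
    fun t _ => (neg_neg _).symm, fun t ht => ?_⟩
  obtain ⟨l, hl⟩ := (noSlip_iff h hΓ).1 hs t ht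
  have h3 := hasDerivAt_cov_dot_vec (h1 t ht) (h2 t ht)
  rw [hl, add_dotProduct, smul_dotProduct, (Γ t).cov_dot_vec, dotProduct_comm ((Γ t).vec ⨯₃ _),
    dot_self_cross, smul_eq_mul, mul_one, zero_add] at h3
  rw [hl, eq_neg_of_add_eq_zero_left h3]

end Curves

/-! ### Rolling along integral curves -/

theorem exists_transported_point {C D : ℝ → Plane} {Q P : ℝ → R3} {a b k a' b' k' : ℝ → ℝ}
    {I : Set ℝ} (hQ : MovingFrame C Q a b k I) (hP : MovingFrame D P a' b' k' I) {t : ℝ} (ht : t ∈ I)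
    (x : Plane) : ∃ y : Plane, ∀ ξ η ζ, frameComb Q t ξ η ζ ∈ x.submodule →
      frameComb P t ξ η ζ ∈ y.submodule := by
  obtain ⟨ξ₀, η₀, ζ₀, h0⟩ := hQ.exists_comb ht x.rep
  have hne : frameComb P t ξ₀ η₀ ζ₀ ≠ 0 := by
    rw [ne_eq, hP.comb_eq_zero_iff ht, ← hQ.comb_eq_zero_iff ht, ← h0]
    exact x.rep_nonzero
  refine ⟨Projectivization.mk ℝ _ hne, fun ξ η ζ hx => ?_⟩
  obtain ⟨r, hr⟩ := (mem_iff_smul x.rep_nonzero (rep_mem x)).1 hx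
  have h1 : frameComb Q t ξ η ζ = frameComb Q t (r * ξ₀) (r * η₀) (r * ζ₀) := by
    rw [← hr, h0]
    simp only [frameComb]
    module
  obtain ⟨rfl, rfl, rfl⟩ := hQ.comb_inj ht h1
  have h2 : frameComb P t (r * ξ₀) (r * η₀) (r * ζ₀) = r • frameComb P t ξ₀ η₀ ζ₀ := by
    simp only [frameComb]
    module
  rw [h2]
  exact Submodule.smul_mem _ _ (mem_mk_self _ _)

theorem lineOf_map_rep {q p : Plane} (ψ : Tang q ≃ₗ[ℝ] Tang p) (u : ℙ ℝ (Tang q)) :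
    lineOf (Projectivization.map (ψ : Tang q →ₗ[ℝ] Tang p) ψ.injective u).rep =
      lineOf (ψ u.rep) := by
  have h1 : Projectivization.map (ψ : Tang q →ₗ[ℝ] Tang p) ψ.injective u =
      Projectivization.mk ℝ (ψ u.rep) (by simpa using u.rep_nonzero) := by
    conv_lhs => rw [← u.mk_rep]
    rfl
  rw [h1, lineOf_mk_rep]

/-- For `l = 0` the two frames share `b` and `c`, and `q × ·` keeps the coordinates of directions.
Copying frame coordinates therefore carries a development of `q` to a development of `p` that
induces `ψ u`. -/
theorem noTwist_of_l_eq_zero {Γ : ℝ → Q5} {c : ℝ → PC} {I : Set ℝ}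
    (h : ∀ s, Corresponds (Γ s) (c s)) {a b k l : ℝ → ℝ}
    (hS : SlipFreePair (fun t => (c t).q) (fun t => (c t).p) (fun s => (Γ s).vec)
      (fun s => (Γ s).cov) a b k l I) (hl : ∀ t ∈ I, l t = 0) : NoTwist c I := by
  obtain ⟨a', hP⟩ := hS.exists_dual_frame
  have hQ := hS.frame
  have hl' : ∀ t ∈ I, deriv l t = 0 := fun t ht => by
    have : l =ᶠ[𝓝 t] fun _ => 0 := by
      filter_upwards [hQ.isOpen.mem_nhds ht] with s hs using hl s hs
    rw [this.deriv_eq, deriv_const]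
  rintro u ⟨x, hx, hu⟩
  have hex : ∀ t, ∃ y : Plane, t ∈ I → ∀ ξ η ζ,
      frameComb (fun s => (Γ s).vec) t ξ η ζ ∈ (x t).submodule →
      frameComb (fun s => (Γ s).cov) t ξ η ζ ∈ y.submodule := fun t => by
    by_cases ht : t ∈ I
    · obtain ⟨y, hy⟩ := exists_transported_point hQ hP ht (x t)
      exact ⟨y, fun _ => hy⟩
    · exact ⟨x t, fun h' => absurd h' ht⟩
  choose y hy using hex
  have key : ∀ t ∈ I, ∃ ξ η ζ : ℝ, frameComb (fun s => (Γ s).vec) t ξ η ζ ≠ 0 ∧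
      frameComb (fun s => (Γ s).vec) t ξ η ζ ∈ (x t).submodule := fun t _ => by
    obtain ⟨ξ, η, ζ, h0⟩ := hQ.exists_comb (by assumption) (x t).rep
    exact ⟨ξ, η, ζ, h0 ▸ (x t).rep_nonzero, h0 ▸ rep_mem _⟩
  have hne : ∀ t ∈ I, ∀ ξ η ζ : ℝ, frameComb (fun s => (Γ s).vec) t ξ η ζ ≠ 0 →
      frameComb (fun s => (Γ s).cov) t ξ η ζ ≠ 0 := fun t ht ξ η ζ h0 => by
    rwa [ne_eq, hP.comb_eq_zero_iff ht, ← hQ.comb_eq_zero_iff ht]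
  refine ⟨y, fun t ht => ⟨?_, ?_⟩, fun t ht => ?_⟩
  · obtain ⟨ξ, η, ζ, h0, h1⟩ := key t ht
    have h2 := (hQ.onOsculatingConic_iff ht h0 h1).1 (hx t ht).1
    rw [hP.onOsculatingConic_iff ht (hne t ht _ _ _ h0) (hy t ht _ _ _ h1), hl t ht, hl' t ht]
    linear_combination h2
  · obtain ⟨ξ, η, ζ, ξ', η', ζ', μ, k1, k2, k3, k4, k5, k6⟩ :=
      (hQ.exists_velocity_iff ht).1 (hx t ht).2
    refine (hP.exists_velocity_iff ht).2 ⟨ξ, η, ζ, ξ', η', ζ', μ, k1, k2, k3, ?_, ?_, k6⟩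
    · filter_upwards [k4, hQ.isOpen.mem_nhds ht] with s hs hsI
      exact ⟨hne s hsI _ _ _ hs.1, hy s hsI _ _ _ hs.2⟩
    · rw [hl t ht, hl' t ht, ← k5]
      ring
  · obtain ⟨ξ, η, ζ, h0, h1⟩ := key t ht
    have h2 := (hQ.onOsculatingConic_iff ht h0 h1).1 (hx t ht).1
    have hη : ζ = 0 → η = 0 := by
      rintro rfl
      simpa using h2
    obtain ⟨X, hX⟩ := exists_isDPi_right (Γ t).vec_ne_zero (h t).vec_mem (u t).rep
    obtain ⟨w, y', z, rfl⟩ := hQ.exists_comb ht X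
    have h3 := (hQ.isStereographic_iff ht rfl (u t).rep_nonzero hX h0 h1 hη).1 (hu t ht)
    obtain ⟨w', hw'⟩ := hS.cross_comb ht w y' z
    have hX' := (h t).2.2 _ _ hX
    rw [hw', hl t ht, zero_mul, sub_zero] at hX'
    exact (hP.isStereographic_iff ht (lineOf_map_rep _ _) (by simpa using (u t).rep_nonzero) hX'
      (hne t ht _ _ _ h0) (hy t ht _ _ _ h1) hη).2 h3

/-! ### Parallel sections and the no-twist condition -/

theorem exists_proj_tang (q : Plane) : Nonempty (ℙ ℝ (Tang q)) := by
  obtain ⟨X, hX⟩ := exists_cross_ne_zero q.rep_nonzero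
  obtain ⟨v, hv⟩ := exists_isDPi q.rep_nonzero (rep_mem q) X
  exact ⟨Projectivization.mk ℝ v fun h0 => hX (hv.eq_zero_iff.1 h0)⟩

/-- Parallel sections with a given initial direction, transversal to the curve, exist. -/
theorem MovingFrame.exists_isParallel {C : ℝ → Plane} {A : ℝ → R3} {a b c : ℝ → ℝ} {I : Set ℝ}
    (h : MovingFrame C A a b c I) (hc : I.OrdConnected) {t₀ : ℝ} (ht₀ : t₀ ∈ I) (s₀ : ℝ) :
    ∃ m n m' n' : ℝ → ℝ, m t₀ = s₀ * n t₀ ∧ n t₀ ≠ 0 ∧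
      (∀ t ∈ I, HasDerivAt m (m' t) t ∧ HasDerivAt n (n' t) t ∧
        m' t * n t - m t * n' t = m t ^ 2 / 2 + 2 * c t / 3 * m t * n t +
          (-b t / 2 - deriv c t / 6 + c t ^ 2 / 18) * n t ^ 2) ∧
      ∃ u : ∀ t, ℙ ℝ (Tang (C t)), IsParallel C u I ∧
        ∀ t ∈ I, ∃ r : ℝ, r ≠ 0 ∧ IsDPi (A t) (frameComb A t 0 (r * m t) (r * n t)) (u t).rep := by
  have hcs : ContinuousOn c I := fun t ht => (h.smooth_c t ht).continuousAt.continuousWithinAt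
  have hbs : ContinuousOn b I := fun t ht => (h.smooth_b t ht).continuousAt.continuousWithinAt
  have hcs' : ContinuousOn (deriv c) I := fun t ht =>
    (h.smooth_c t ht).deriv_infty.continuousAt.continuousWithinAt
  -- The coefficients come from eliminating `μ` from the two development equations along the
  -- parametrized conic.
  obtain ⟨m, n, m', n', h0, hn0, hmn⟩ := exists_riccati_solution h.isOpen hc
    (α := fun t => 2 * c t / 3) (e := fun t => -b t / 2 - deriv c t / 6 + c t ^ 2 / 18)
    (by fun_prop) (by fun_prop) ht₀ s₀
  refine ⟨m, n, m', n', h0, hn0, fun t ht => ⟨(hmn t ht).1, (hmn t ht).2.1, (hmn t ht).2.2.2⟩, ?_⟩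
  have hu : ∀ t, ∃ u : ℙ ℝ (Tang (C t)), t ∈ I → ∃ r : ℝ, r ≠ 0 ∧
      IsDPi (A t) (frameComb A t 0 (r * m t) (r * n t)) u.rep := fun t => by
    by_cases ht : t ∈ I
    · obtain ⟨v, hv⟩ := exists_isDPi (h.lift t ht).1 (h.lift t ht).2 (frameComb A t 0 (m t) (n t))
      have hv0 : v ≠ 0 := by
        rw [ne_eq, h.tang_eq_zero_iff ht hv, not_and_or]
        exact (hmn t ht).2.2.1
      obtain ⟨r, hr⟩ := Projectivization.exists_smul_eq_mk_rep ℝ v hv0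
      refine ⟨Projectivization.mk ℝ v hv0, fun _ => ⟨r, r.ne_zero, ?_⟩⟩
      rw [← hr]
      change IsDPi _ _ ((r : ℝ) • v)
      convert hv.const_smul (r : ℝ) using 1
      simp only [frameComb]
      module
    · exact ⟨(exists_proj_tang _).some, fun h' => absurd h' ht⟩
  choose u hu using hu
  refine ⟨u, ?_, hu⟩
  -- The conic equation solved for `ξ` at `η = mn`, `ζ = n²`: the rational parametrization of the
  -- conic by the direction `(m : n)`.
  set ξ : ℝ → ℝ := fun t => (m t ^ 2 + 2 * c t / 3 * m t * n t +
    (deriv c t / 3 - c t ^ 2 / 9 - b t) * n t ^ 2) / 2 with hξ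
  have hne : ∀ t ∈ I, frameComb A t (ξ t) (m t * n t) (n t ^ 2) ≠ 0 := fun t ht => by
    rw [ne_eq, h.comb_eq_zero_iff ht]
    rintro ⟨k1, _, k3⟩
    have hn : n t = 0 := by simpa using k3
    have hm : m t = 0 := by simpa [hξ, hn] using k1
    exact (hmn t ht).2.2.1.elim (fun h' => h' hm) fun h' => h' hn
  have hx : ∀ t, ∃ x : Plane, t ∈ I → frameComb A t (ξ t) (m t * n t) (n t ^ 2) ∈ x.submodule :=
    fun t => by
      by_cases ht : t ∈ I
      · exact ⟨Projectivization.mk ℝ _ (hne t ht), fun _ => mem_mk_self _ _⟩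
      · exact ⟨C t, fun h' => absurd h' ht⟩
  choose x hx using hx
  refine ⟨x, fun t ht => ⟨?_, ?_⟩, fun t ht => ?_⟩
  · rw [h.onOsculatingConic_iff ht (hne t ht) (hx t ht), hξ]
    ring
  · obtain ⟨hm, hn, hnz, hric⟩ := hmn t ht
    have hb := (h.smooth_b t ht).hasDerivAt_infty
    have hcd := (h.smooth_c t ht).hasDerivAt_infty
    have hcd' := (h.smooth_c t ht).deriv_infty.hasDerivAt_infty
    obtain ⟨ξ', hξ'⟩ : ∃ ξ', HasDerivAt ξ ξ' t :=
      ⟨_, ((((hm.pow 2).add ((((hcd.const_mul 2).div_const 3).mul hm).mul hn)).add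
        ((((hcd'.div_const 3).sub ((hcd.pow 2).div_const 9)).sub hb).mul (hn.pow 2))).div_const 2)⟩
    have hη := hm.mul hn
    have hζ : HasDerivAt (fun s => n s ^ 2) (2 * n t * n' t) t :=
      (hn.fun_pow 2).congr_deriv (by norm_num)
    -- For `n ≠ 0` the second equation defines `μ` and the first becomes the Riccati equation. For
    -- `n = 0` the point is the cusp: the Riccati equation gives `ξ + m n' = 0`, and `μ = 0` works.
    obtain ⟨μ, e1, e2⟩ : ∃ μ : ℝ,
        ξ t + (m' t * n t + m t * n' t) + b t * n t ^ 2 = μ * (m t * n t) ∧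
        m t * n t + 2 * n t * n' t + c t * n t ^ 2 = μ * n t ^ 2 := by
      by_cases hn0 : n t = 0
      · rw [hn0] at hric
        refine ⟨0, ?_, ?_⟩
        · simp only [hξ, hn0]
          linear_combination -hric
        · rw [hn0]
          ring
      · refine ⟨(m t * n t + 2 * n t * n' t + c t * n t ^ 2) / n t ^ 2, ?_, by field_simp⟩
        rw [div_mul_eq_mul_div, eq_div_iff (pow_ne_zero 2 hn0)]
        simp only [hξ]
        linear_combination (n t ^ 2) * hric
    refine (h.exists_velocity_iff ht).2 ⟨ξ, fun s => m s * n s, fun s => n s ^ 2, ξ', _, _, μ, hξ',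
      hη, hζ, ?_, e1, e2⟩
    filter_upwards [h.isOpen.mem_nhds ht] with s hs using ⟨hne s hs, hx s hs⟩
  · obtain ⟨r, hr0, hr⟩ := hu t ht
    refine (h.isStereographic_iff ht rfl (u t).rep_nonzero hr (hne t ht) (hx t ht) ?_).2 ⟨?_, ?_⟩
    · intro hn
      rw [pow_eq_zero_iff two_ne_zero] at hn
      rw [hn, mul_zero]
    · intro hn
      rw [pow_eq_zero_iff two_ne_zero] at hn
      rw [hn, mul_zero]
    · ring

/-- Comparison of two Riccati equations whose solutions differ by `l`. -/
theorem riccati_compare {b c c' l l' s m n m' n' ξ η ζ η' ζ' μ : ℝ} (hm : m = s * n) (hn : n ≠ 0)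
    (hζ : ζ ≠ 0) (hst : η * n = ζ * (m - l * n))
    (hst' : η' * n + η * n' = ζ' * (m - l * n) + ζ * (m' - (l' * n + l * n')))
    (hric : m' * n - m * n' =
      m ^ 2 / 2 + 2 * c / 3 * m * n + (-b / 2 - c' / 6 + c ^ 2 / 18) * n ^ 2)
    (hconic : η ^ 2 - 2 * ξ * ζ + 2 * c / 3 * η * ζ +
      (c' / 3 - c ^ 2 / 9 - (b + 3 * l' - c * l)) * ζ ^ 2 = 0)
    (h1 : ξ + η' + (b + 3 * l' - c * l) * ζ = μ * η) (h2 : η + ζ' + c * ζ = μ * ζ) :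
    l * s = l ^ 2 / 2 - c * l / 6 - l' / 2 := by
  subst hm
  have hη : η = ζ * (s - l) := by
    apply mul_right_cancel₀ hn
    linear_combination hst
  subst hη
  have k1 : m' - s * n' = n * (s ^ 2 / 2 + 2 * c / 3 * s + (-b / 2 - c' / 6 + c ^ 2 / 18)) := by
    apply mul_right_cancel₀ hn
    linear_combination hric
  have k2 : η' - (s - l) * ζ' =
      ζ * (s ^ 2 / 2 + 2 * c / 3 * s + (-b / 2 - c' / 6 + c ^ 2 / 18) - l') := by
    apply mul_right_cancel₀ hn
    linear_combination hst' + ζ * k1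
  have k3 : 2 * ξ = ζ * ((s - l) ^ 2 + 2 * c / 3 * (s - l) +
      (c' / 3 - c ^ 2 / 9 - (b + 3 * l' - c * l))) := by
    apply mul_right_cancel₀ hζ
    linear_combination -hconic
  have k4 : η' - (s - l) * ζ' =
      ζ * ((s - l) ^ 2 + c * (s - l) - (b + 3 * l' - c * l)) - ξ := by
    linear_combination h1 - (s - l) * h2
  apply mul_right_cancel₀ hζ
  linear_combination k4 - k2 - k3 / 2

/-- No-twist is applied to a parallel section of arbitrary slope `s₀` at `t₀`. The resulting
relation is affine in `s₀` with leading coefficient `l t₀`. -/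
theorem l_eq_zero_of_noTwist {Γ : ℝ → Q5} {c : ℝ → PC} {I : Set ℝ} (hI : I.OrdConnected)
    (h : ∀ s, Corresponds (Γ s) (c s)) {a b k l : ℝ → ℝ}
    (hS : SlipFreePair (fun t => (c t).q) (fun t => (c t).p) (fun s => (Γ s).vec)
      (fun s => (Γ s).cov) a b k l I) (hT : NoTwist c I) : ∀ t ∈ I, l t = 0 := by
  intro t₀ ht₀
  obtain ⟨a', hP⟩ := hS.exists_dual_frame
  have hQ := hS.frame
  have key : ∀ s₀ : ℝ, l t₀ * s₀ = l t₀ ^ 2 / 2 - k t₀ * l t₀ / 6 - deriv l t₀ / 2 := by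
    intro s₀
    obtain ⟨m, n, m', n', hm0, hn0, hmn, u, hu, hrep⟩ := hQ.exists_isParallel hI ht₀ s₀
    obtain ⟨y, hy, hyu⟩ := hT u hu
    obtain ⟨ξ, η, ζ, ξ', η', ζ', μ, _, hη, hζ, hX, h1, h2⟩ :=
      (hP.exists_velocity_iff ht₀).1 (hy t₀ ht₀).2
    have hconic : ∀ᶠ t in 𝓝 t₀, η t ^ 2 - 2 * ξ t * ζ t + 2 * k t / 3 * η t * ζ t +
        (deriv k t / 3 - k t ^ 2 / 9 - (b t + 3 * deriv l t - k t * l t)) * ζ t ^ 2 = 0 := by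
      filter_upwards [hX, hQ.isOpen.mem_nhds ht₀] with t ht htI
      exact (hP.onOsculatingConic_iff htI ht.1 ht.2).1 (hy t htI).1
    -- The dual development has slope `m / n - l`. The relation is needed near `t₀`, not only at
    -- `t₀`, because it is differentiated; its first half gives `ζ t₀ ≠ 0` from `n t₀ ≠ 0`.
    have hst : ∀ᶠ t in 𝓝 t₀, (ζ t = 0 → n t = 0) ∧ η t * n t = ζ t * (m t - l t * n t) := by
      filter_upwards [hX, hQ.isOpen.mem_nhds ht₀, hconic] with t ht htI htc
      obtain ⟨r, hr0, hr⟩ := hrep t htI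
      obtain ⟨w', hw'⟩ := hS.cross_comb htI 0 (r * m t) (r * n t)
      have hr' := (h t).2.2 _ _ hr
      rw [hw'] at hr'
      have h3 := (hP.isStereographic_iff htI (lineOf_map_rep _ _) (by simpa using (u t).rep_nonzero)
        hr' ht.1 ht.2 (fun hz => by simpa [hz] using htc)).1 (hyu t htI)
      refine ⟨fun hz => (mul_eq_zero.1 (h3.1 hz)).resolve_left hr0, ?_⟩
      apply mul_left_cancel₀ hr0
      linear_combination h3.2
    obtain ⟨dm, dn, hric⟩ := hmn t₀ ht₀
    have hl := (hS.smooth_l t₀ ht₀).hasDerivAt_infty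
    have hst' := (hη.mul dn).unique ((hζ.mul (dm.sub (hl.mul dn))).congr_of_eventuallyEq
      (by filter_upwards [hst] with t ht using ht.2))
    exact riccati_compare hm0 hn0 (fun hz => hn0 (hst.self_of_nhds.1 hz)) hst.self_of_nhds.2 hst'
      hric hconic.self_of_nhds h1 h2
  have k0 := key 0
  have k1 := key 1
  linarith

end ProjRolling

/-! ### The proposition -/

theorem mainTheorem9 :
    ∃ Φ : ProjRolling.Q5 ≃ ProjRolling.PC,
      (∀ x : ProjRolling.Q5, ProjRolling.Corresponds x (Φ x)) ∧
      ∀ I : Set ℝ, IsOpen I → I.OrdConnected → ∀ Γ : ℝ → ProjRolling.Q5,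
        (ProjRolling.Q5.SmoothCurveOn Γ I ↔
          ProjRolling.PC.SmoothCurveOn (fun t => Φ (Γ t)) I) ∧
        (ProjRolling.Q5.SmoothCurveOn Γ I →
          ProjRolling.LocallyConvexOn (fun t => (Φ (Γ t)).q) I →
          (ProjRolling.IsIntegralCurve Γ I ↔
            (ProjRolling.NoSlip (fun t => Φ (Γ t)) I ∧
              ProjRolling.NoTwist (fun t => Φ (Γ t)) I))) := by
  refine ⟨ProjRolling.contactEquiv, ProjRolling.contactEquiv_corresponds, fun I hI hc Γ => ?_⟩
  have h := fun t => ProjRolling.contactEquiv_corresponds (Γ t)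
  refine ⟨⟨ProjRolling.SmoothCurveOn.toPC h, ProjRolling.SmoothCurveOn.ofPC h⟩, fun hΓ hconv => ?_⟩
  rw [ProjRolling.isIntegralCurve_iff hΓ]
  constructor
  · intro hint
    have hs := (ProjRolling.noSlip_iff h hΓ).2 fun t ht => ⟨0, by rw [hint t ht]; simp⟩
    obtain ⟨a, b, k, hS⟩ := ProjRolling.exists_slipFreePair h hI hΓ hconv hs
    refine ⟨hs, ProjRolling.noTwist_of_l_eq_zero h hS fun t ht => ?_⟩
    have h1 := hS.deriv_eq t ht
    -- Comparing `p' = q × q'` with `p' = q × q' + l p` leaves `l p = 0`, and `p ≠ 0`.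
    rw [hint t ht, left_eq_add, smul_eq_zero] at h1
    exact h1.resolve_right (Γ t).cov_ne_zero
  · rintro ⟨hs, hT⟩ t ht
    obtain ⟨a, b, k, hS⟩ := ProjRolling.exists_slipFreePair h hI hΓ hconv hs
    have h1 := hS.deriv_eq t ht
    rwa [ProjRolling.l_eq_zero_of_noTwist hc h hS hT t ht, zero_smul, add_zero] at h1
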